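/- Let $k$ be a finite field, $n\ge 1$, $G=\mathrm{GL}_n(k)$. For a partition $\lambda=(\lambda_1\ge\lambda_2\ge\cdots)$ of $n$ with $l(\lambda)$ nonzero parts, let $X_\lambda$ be the set of $\lambda$-flags, i.e. chains of subspaces $k^n=x_{l(\lambda)}\supset x_{l(\lambda)-1}\supset\cdots\supset x_0=0$ with $\dim(x_{l(\lambda)-i+1}/x_{l(\lambda)-i})=\lambda_i$ for $1\le i\le l(\lambda)$. Let $\mathcal F_\lambda=\mathbb Q(X_\lambda)$ be the space of $\mathbb Q$-valued functions on $X_\lambda$, with $G$ acting by $(gf)(x)=f(g^{-1}x)$, and let $\mathcal H_\lambda=\mathrm{End}_G(\mathcal F_\lambda)$. For a $G$-orbit $\Omega\subset X_\lambda\times X_\mu$ define $\mathbf g_\Omega\in\mathrm{Hom}_G(\mathcal F_\mu,\mathcal F_\lambda)$ by $(\mathbf g_\Omega f)(x)=\sum_{y:(x,y)\in\Omega}f(y)$, and let $\Omega^{\mathrm{op}}=\{(y,x):(x,y)\in\Omega\}$. Write $\nu\le\lambda$ if $\sum_{j\le i}\nu_j\ge\sum_{j\le i}\lambda_j$ for all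 $i$ (opposite dominance order), and let $\Lambda_\lambda$ be the set of partitions $\nu$ of $n$ with $\nu\le\lambda$. For $z\in X_\nu$ and $x\in X_\lambda$, put $z^{(i)}=z_{l(\nu)-i}$ and $x^{(j)}=x_{l(\lambda)-j}$ (zero for $i\ge l(\nu)$, resp. $j\ge l(\lambda)$), and $$a_{ij}=\dim_k\frac{z^{(i-1)}\cap x^{(j-1)}}{z^{(i-1)}\cap x^{(j)}+z^{(i)}\cap x^{(j-1)}}\qquad(i,j\ge1).$$ The flag $z$ is permissibly embedded in $x$ if $l(\nu)\le l(\lambda)$, $z^{(i)}\subset x^{(i)}$ for $1\le i\le l(\nu)$, and the tableau of shape $\nu$ whose $i$-th row consists, in weakly increasing order, of $a_{ij}$ entries equal to $j$ for each $j$, is semistandard (its columns are strictly increasing). Let $(X_\nu\times_G X_\lambda)^\circ$ be the set of $G$-orbits of pairs $(z,x)\in X_\nu\times X_\lambda$ such that $z$ is permissibly embedded in $x$, and for $\Omega_1,\Omega_2\in(X_\nu\times_GX_\lambda)^\circ$ put $$\mathbf c^\nu_{\Omega_1\Omega_2}=\mathbf g_{\Omega_1^{\mathrm{op}}}\circ\mathbf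 g_{\Omega_2}\in\mathcal H_\lambda .$$ **Theorem.** The Hecke algebra $\mathcal H_\lambda$ is a cellular algebra, with cellular basis $\mathcal C_{\lambda\lambda}=\{\mathbf c^\nu_{\Omega_1\Omega_2}:\nu\in\Lambda_\lambda,\ \Omega_1,\Omega_2\in(X_\nu\times_GX_\lambda)^\circ\}$ indexed by the poset $\Lambda_\lambda$. That is: 1. The family $(\mathbf c^\nu_{\Omega_1\Omega_2})$, indexed by all triples $(\nu,\Omega_1,\Omega_2)$ as above, is a $\mathbb Q$-basis of $\mathcal H_\lambda$. 2. The $\mathbb Q$-linear map determined by $\mathbf c^\nu_{\Omega_1\Omega_2}\mapsto\mathbf c^\nu_{\Omega_2\Omega_1}$ is an algebra anti-homomorphism of $\mathcal H_\lambda$ (hence an anti-involution). 3. For all $\nu\in\Lambda_\lambda$, $\Omega_1\in(X_\nu\times_GX_\lambda)^\circ$ and $a\in\mathcal H_\lambda$ there are $\alpha_\Omega\in\mathbb Q$, for $\Omega\in(X_\nu\times_GX_\lambda)^\circ$, such that for every $\Omega_2\in(X_\nu\times_GX_\lambda)^\circ$ $$a\,\mathbf c^\nu_{\Omega_1\Omega_2}\equiv\sum_{\Omega}\alpha_\Omega\,\mathbf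 c^\nu_{\Omega\,\Omega_2}\pmod{\mathcal H_\lambda^{\nu-}},$$ where $\mathcal H_\lambda^{\nu-}$ is the span of all $\mathbf c^\omega_{\Omega'\Omega''}$ with $\omega\in\Lambda_\lambda$, $\omega<\nu$, i.e. with $\omega\neq\nu$ dominating $\nu$. -/

import Mathlib

/-! ### Cellular algebras -/

/-- The family `c τ s t` (`τ ∈ ζ`, `s t ∈ T τ`) is a cellular basis of the `K`-algebra `A` over the
finite poset `ζ`. Elements of `A` are multiplied on the left, and the lower-order terms of
`c τ s t` are the `c ω u v` with `ω > τ`. -/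
structure IsCellularBasis (K : Type*) {A ζ : Type*} [Field K] [Ring A] [Algebra K A]
    [PartialOrder ζ] [Finite ζ] {T : ζ → Type*} [∀ τ, Fintype (T τ)]
    (c : ∀ τ, T τ → T τ → A) : Prop where
  /-- The family is linearly independent (in particular its members are distinct). -/
  linearIndependent :
    LinearIndependent K (fun p : Σ τ, T τ × T τ => c p.1 p.2.1 p.2.2)
  /-- The family spans the algebra. -/
  span_eq_top :
    Submodule.span K (Set.range (fun p : Σ τ, T τ × T τ => c p.1 p.2.1 p.2.2)) = ⊤
  /-- The linear map `c τ s t ↦ c τ t s` is an anti-homomorphism of algebras. -/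
  exists_star :
    ∃ star : A →ₐ[K] Aᵐᵒᵖ, ∀ τ (s t : T τ), star (c τ s t) = MulOpposite.op (c τ t s)
  /-- Left multiplication by `a` on `c τ s t` has, modulo the span of the `c ω u v` with `ω > τ`,
  coefficients which do not depend on `t`. -/
  mul_mod : ∀ τ (s : T τ) (a : A), ∃ α : T τ → K, ∀ t : T τ,
    a * c τ s t - ∑ v, α v • c τ v t ∈
      Submodule.span K {x : A | ∃ ω, τ < ω ∧ ∃ u v : T ω, x = c ω u v}

/-- An algebra is cellular if it has a cellular basis. -/
def IsCellularAlgebra.{u, v} (K : Type u) (A : Type v) [Field K] [Ring A] [Algebra K A] :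
    Prop :=
  ∃ (ζ : Type) (_ : PartialOrder ζ) (_ : Finite ζ) (T : ζ → Type v) (_ : ∀ τ, Fintype (T τ))
    (c : ∀ τ, T τ → T τ → A), IsCellularBasis K c

namespace FlagHecke

/-! ### Partitions -/

/-- The parts of a partition, in non-increasing order. -/
def rows {n : ℕ} (μ : n.Partition) : List ℕ := μ.parts.sort (· ≥ ·)

/-- `row μ i` is the part `μ_{i+1}` (zero beyond the length of `μ`). -/
def row {n : ℕ} (μ : n.Partition) (i : ℕ) : ℕ := (rows μ).getD i 0

/-- The number of nonzero parts. -/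
def length {n : ℕ} (μ : n.Partition) : ℕ := (rows μ).length

/-- The Young diagram of a partition: its `i`-th row has `row μ i` boxes. -/
def diagram {n : ℕ} (μ : n.Partition) : YoungDiagram :=
  YoungDiagram.ofRowLens (rows μ) (Multiset.pairwise_sort μ.parts (· ≥ ·)).sortedGE

/-- `Dominates μ ν`: the partition `μ` dominates `ν`, i.e. the partial sums of `μ` are at least
those of `ν`. In the opposite dominance order this reads `μ ≤ ν`. -/
def Dominates {n : ℕ} (μ ν : n.Partition) : Prop :=
  ∀ i, ∑ j ∈ Finset.range i, row ν j ≤ ∑ j ∈ Finset.range i, row μ j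

lemma rows_injective {n : ℕ} : Function.Injective (rows : n.Partition → List ℕ) := by
  intro μ ν h
  have h' := congrArg (fun l : List ℕ => (l : Multiset ℕ)) h
  simp only [rows, Multiset.sort_eq] at h'
  exact Nat.Partition.ext h'

lemma row_injective {n : ℕ} : Function.Injective (row : n.Partition → ℕ → ℕ) := by
  intro μ ν h
  apply rows_injective
  have pos : ∀ (κ : n.Partition) i, i < (rows κ).length → row κ i ≠ 0 := by
    intro κ i hi
    have hm : (rows κ)[i] ∈ κ.parts := by
      rw [← Multiset.mem_sort (r := (· ≥ ·))]; exact List.getElem_mem hi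
    simpa [row, List.getElem?_eq_getElem hi] using (κ.parts_pos hm).ne'
  have out : ∀ (κ : n.Partition) i, (rows κ).length ≤ i → row κ i = 0 := by
    intro κ i hi
    simp [row, List.getElem?_eq_none hi]
  have hl : (rows μ).length = (rows ν).length := by
    apply le_antisymm
    · by_contra hc
      exact pos μ _ (not_le.mp hc) ((congrFun h _).trans (out ν _ le_rfl))
    · by_contra hc
      exact pos ν _ (not_le.mp hc) ((congrFun h _).symm.trans (out μ _ le_rfl))
  refine List.ext_getElem hl fun i h1 h2 => ?_
  simpa [row, List.getElem?_eq_getElem h1, List.getElem?_eq_getElem h2] using congrFun h i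

/-- The set `Λ_μ` of partitions `ν` of `n` with `ν ≤ μ` in the opposite dominance order,
i.e. of those which dominate `μ`. -/
def Below {n : ℕ} (μ : n.Partition) : Type := {ν : n.Partition // Dominates ν μ}

instance {n : ℕ} (μ : n.Partition) : Finite (Below μ) :=
  inferInstanceAs (Finite {ν : n.Partition // Dominates ν μ})

/-- `Λ_μ` ordered by dominance: `ν < ω` means that `ω ≠ ν` dominates `ν`. -/
instance {n : ℕ} (μ : n.Partition) : PartialOrder (Below μ) where
  le ν ω := Dominates ω.1 ν.1
  le_refl _ _ := le_rfl
  le_trans _ _ _ h₁ h₂ i := (h₁ i).trans (h₂ i)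
  le_antisymm ν ω h₁ h₂ := by
    apply Subtype.ext
    apply row_injective
    funext i
    have h : ∀ i, ∑ j ∈ Finset.range i, row ν.1 j = ∑ j ∈ Finset.range i, row ω.1 j :=
      fun i => le_antisymm (h₁ i) (h₂ i)
    have := h (i + 1)
    rw [Finset.sum_range_succ, Finset.sum_range_succ, h i] at this
    exact Nat.add_left_cancel this

/-! ### Flags -/

section Flags

variable {k : Type*} [Field k] {n : ℕ}

/-- A `μ`-flag `kⁿ = x_l ⊃ x_{l-1} ⊃ ⋯ ⊃ x_0 = 0`, where `l = length μ` and
`dim (x_{l-i+1} / x_{l-i}) = μ_i`. The chain is indexed from the top: `space i` is `x_{l-i}`, and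
`space i = 0` for `i ≥ l`. -/
@[ext]
structure Flag (k : Type*) [Field k] {n : ℕ} (μ : n.Partition) where
  /-- The subspaces of the flag, from the top downwards. -/
  space : ℕ → Submodule k (Fin n → k)
  antitone : Antitone space
  space_zero : space 0 = ⊤
  space_eq_bot : ∀ i, length μ ≤ i → space i = ⊥
  finrank_eq : ∀ i, Module.finrank k (space i) = Module.finrank k (space (i + 1)) + row μ i

instance [Finite k] (μ : n.Partition) : Finite (Flag k μ) := by
  have : Finite (Submodule k (Fin n → k)) :=
    Finite.of_injective (fun W => (W : Set (Fin n → k))) SetLike.coe_injective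
  refine Finite.of_injective
    (fun (x : Flag k μ) (i : Fin (length μ)) => x.space i) fun x y h => ?_
  ext1
  funext i
  by_cases hi : i < length μ
  · exact congrFun h ⟨i, hi⟩
  · rw [x.space_eq_bot i (not_lt.mp hi), y.space_eq_bot i (not_lt.mp hi)]

noncomputable instance [Finite k] (μ : n.Partition) : Fintype (Flag k μ) := Fintype.ofFinite _

/-- The linear automorphism `v ↦ g v` of `kⁿ`. -/
def glEquiv (g : GL (Fin n) k) : (Fin n → k) ≃ₗ[k] (Fin n → k) :=
  LinearMap.GeneralLinearGroup.toLinearEquiv (Matrix.GeneralLinearGroup.toLin g)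

lemma glEquiv_apply (g : GL (Fin n) k) (v : Fin n → k) :
    glEquiv g v = (g : Matrix (Fin n) (Fin n) k).mulVec v := rfl

/-- `GL_n(k)` acts on flags by taking images of subspaces. -/
instance (μ : n.Partition) : MulAction (GL (Fin n) k) (Flag k μ) where
  smul g x :=
    { space := fun i => (x.space i).map (glEquiv g : (Fin n → k) →ₗ[k] (Fin n → k))
      antitone := fun _ _ h => Submodule.map_mono (x.antitone h)
      space_zero := by rw [x.space_zero, Submodule.map_top, LinearEquiv.range]
      space_eq_bot := fun i hi => by rw [x.space_eq_bot i hi, Submodule.map_bot]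
      finrank_eq := fun i => by
        rw [LinearEquiv.finrank_map_eq, LinearEquiv.finrank_map_eq, x.finrank_eq i] }
  one_smul x := by
    ext i v
    change v ∈ (x.space i).map (glEquiv (1 : GL (Fin n) k) : (Fin n → k) →ₗ[k] (Fin n → k)) ↔ _
    simp only [Submodule.mem_map, LinearEquiv.coe_coe, glEquiv_apply]
    simp
  mul_smul g h x := by
    ext i v
    change v ∈ (x.space i).map (glEquiv (g * h) : (Fin n → k) →ₗ[k] (Fin n → k)) ↔
      v ∈ ((x.space i).map (glEquiv h : (Fin n → k) →ₗ[k] (Fin n → k))).map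
        (glEquiv g : (Fin n → k) →ₗ[k] (Fin n → k))
    simp only [Submodule.mem_map, LinearEquiv.coe_coe, glEquiv_apply]
    simp [Matrix.mulVec_mulVec]

variable (k) in
/-- The permutation representation `F_μ` of `GL_n(k)` on the `ℚ`-valued functions on the set of
`μ`-flags: `(g f)(x) = f(g⁻¹ x)`. -/
def flagRep (μ : n.Partition) : Representation ℚ (GL (Fin n) k) (Flag k μ → ℚ) where
  toFun g := LinearMap.funLeft ℚ ℚ (fun x => g⁻¹ • x)
  map_one' := by ext; simp [LinearMap.funLeft_apply]
  map_mul' g h := by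
    ext f x
    simp [LinearMap.funLeft, mul_smul]

lemma flagRep_apply (μ : n.Partition) (g : GL (Fin n) k) (f : Flag k μ → ℚ) (x : Flag k μ) :
    flagRep k μ g f x = f (g⁻¹ • x) := rfl

variable (k) in
/-- The Hecke module `N_{μν} = Hom_G(F_ν, F_μ)`. -/
abbrev HeckeModule (μ ν : n.Partition) : Type _ :=
  Representation.IntertwiningMap (flagRep k ν) (flagRep k μ)

variable (k) in
/-- The Hecke algebra `H_μ = End_G(F_μ)`, with composition as multiplication. -/
abbrev HeckeAlgebra (μ : n.Partition) : Type _ :=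
  Representation.IntertwiningMap (flagRep k μ) (flagRep k μ)

instance (μ : n.Partition) : Ring (HeckeAlgebra k μ) where
  __ := Representation.IntertwiningMap.instSemiring (flagRep k μ)
  neg_add_cancel := neg_add_cancel
  zsmul := (· • ·)
  sub_eq_add_neg := sub_eq_add_neg
  zsmul_zero' := zero_zsmul
  zsmul_succ' := SubNegMonoid.zsmul_succ'
  zsmul_neg' := SubNegMonoid.zsmul_neg'

/-! ### Orbits and the geometric basis -/

variable (k) in
/-- The set `X_μ ×_G X_ν` of orbits of the diagonal action of `G` on `X_μ × X_ν`. -/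
abbrev Orbit (μ ν : n.Partition) : Type _ :=
  MulAction.orbitRel.Quotient (GL (Fin n) k) (Flag k μ × Flag k ν)

/-- The orbit `[(x, y)]`. -/
def orbitMk {μ ν : n.Partition} (x : Flag k μ) (y : Flag k ν) : Orbit k μ ν :=
  Quotient.mk'' (x, y)

lemma orbitMk_eq_iff {μ ν : n.Partition} {x x' : Flag k μ} {y y' : Flag k ν} :
    orbitMk x y = orbitMk x' y' ↔ ∃ g : GL (Fin n) k, g • x' = x ∧ g • y' = y := by
  rw [orbitMk, orbitMk, Quotient.eq'', MulAction.orbitRel_apply, MulAction.mem_orbit_iff]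
  simp [Prod.ext_iff]

lemma orbitMk_smul {μ ν : n.Partition} (g : GL (Fin n) k) (x : Flag k μ) (y : Flag k ν) :
    orbitMk (g • x) (g • y) = orbitMk x y :=
  orbitMk_eq_iff.mpr ⟨g, rfl, rfl⟩

/-- The opposite orbit: `[(x, y)]ᵒᵖ = [(y, x)]`. -/
def Orbit.op {μ ν : n.Partition} (Ω : Orbit k μ ν) : Orbit k ν μ :=
  Quotient.liftOn' Ω (fun p => orbitMk p.2 p.1) (by
    rintro p q h
    obtain ⟨g, hg⟩ := MulAction.mem_orbit_iff.mp (MulAction.orbitRel_apply.mp h)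
    rw [← hg]
    exact orbitMk_smul g q.2 q.1)

lemma Orbit.op_mk {μ ν : n.Partition} (x : Flag k μ) (y : Flag k ν) :
    Orbit.op (orbitMk x y) = orbitMk y x := rfl

open Classical in
/-- The geometric basis element `g_Ω : F_ν → F_μ`, `(g_Ω f)(x) = ∑_{y : (x, y) ∈ Ω} f(y)`. -/
noncomputable def geom [Finite k] {μ ν : n.Partition} (Ω : Orbit k μ ν) : HeckeModule k μ ν where
  toFun f x := ∑ y : Flag k ν with orbitMk x y = Ω, f y
  map_add' f g := by
    funext x
    simp [Finset.sum_add_distrib]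
  map_smul' a f := by
    funext x
    simp [Finset.mul_sum]
  isIntertwining' g := by
    ext f x
    simp only [LinearMap.comp_apply, LinearMap.coe_mk, AddHom.coe_mk, flagRep_apply]
    refine Finset.sum_equiv (MulAction.toPerm g⁻¹) (fun y => ?_) (fun y _ => rfl)
    simp [orbitMk_smul]

/-! ### Permissible embeddings -/

/-- The `(i, j)` entry (counting from zero) of the intersection matrix of the flags `z` and `x`,
i.e. the dimension of `(Z_i ∩ X_j) / (Z_i ∩ X_{j+1} + Z_{i+1} ∩ X_j)`, the flags being
indexed from the top. Its row sums are the parts of `ν`, its column sums those of `μ`. -/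
noncomputable def interMatrix {ν μ : n.Partition} (z : Flag k ν) (x : Flag k μ) (i j : ℕ) : ℕ :=
  Module.finrank k (↥(z.space i ⊓ x.space j) ⧸
    ((z.space i ⊓ x.space (j + 1)) ⊔ (z.space (i + 1) ⊓ x.space j)).submoduleOf
      (z.space i ⊓ x.space j))

/-- The `ν`-flag `z` is embedded in the `μ`-flag `x`: `l(ν) ≤ l(μ)` and
`z_{l(ν)-i} ⊆ x_{l(μ)-i}` for `1 ≤ i ≤ l(ν)`. -/
def Embedded {ν μ : n.Partition} (z : Flag k ν) (x : Flag k μ) : Prop :=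
  length ν ≤ length μ ∧ ∀ i, 1 ≤ i → i ≤ length ν → z.space i ≤ x.space i

/-- The filling of the diagram of `ν` by weakly increasing rows whose `i`-th row contains the label
`j` exactly `a i j` times is semistandard. (Rows and labels are counted from zero.) -/
def IsSemistandardMatrix (ν : n.Partition) (a : ℕ → ℕ → ℕ) : Prop :=
  ∃ T : SemistandardYoungTableau (diagram ν),
    ∀ i j, ((Finset.range (row ν i)).filter (fun c => T i c = j)).card = a i j

/-- `z` is permissibly embedded in `x`: it is embedded, and the `ν`-tableau of type `μ` given by
the intersection matrix is semistandard. -/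
def Permissible {ν μ : n.Partition} (z : Flag k ν) (x : Flag k μ) : Prop :=
  Embedded z x ∧ IsSemistandardMatrix ν (interMatrix z x)

variable (k) in
/-- The set `(X_ν ×_G X_μ)°` of orbits of pairs `(z, x)` with `z` permissibly embedded in `x`. -/
abbrev PermOrbit (ν μ : n.Partition) : Type _ :=
  {Ω : Orbit k ν μ // ∃ z x, orbitMk z x = Ω ∧ Permissible z x}

noncomputable instance [Finite k] (ν μ : n.Partition) : Fintype (PermOrbit k ν μ) :=
  Fintype.ofFinite _

/-- The element `c^ν_{Ω₁Ω₂} = g_{Ω₁ᵒᵖ} ∘ g_{Ω₂}` of the Hecke algebra `H_μ`, where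
`Ω₁, Ω₂ ∈ (X_ν ×_G X_μ)°`. -/
noncomputable def cellElt [Finite k] (μ : n.Partition) (ν : Below μ)
    (Ω₁ Ω₂ : PermOrbit k ν.1 μ) : HeckeAlgebra k μ :=
  (geom Ω₁.1.op).comp (geom Ω₂.1)

end Flags

end FlagHecke

/-! An intertwiner between flag representations is a matrix ("kernel") on pairs of flags that is
constant on orbits, and composition is matrix multiplication. Two flags have a common adapted basis,
so an orbit is determined by the dimensions of `z_i ∩ x_j`, equivalently by its intersection matrix.
Everything is carried out with kernels.

Spanning rests on straightening (`orbitKer_mem_span`). If semistandardness of `(z₀, x₀)` fails at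
`(i, j)`, put `P₁ = z_{i+1} + z_i ∩ x_j` and `P₂ = z_{i+2} + z_{i+1} ∩ x_{j+1}`. Counting the
conjugates of this configuration with `P₂ ≤ z_{i+1} ≤ P₁` gives an invariant kernel with value `1`
at `(z₀, x₀)`, supported on pairs with larger or equal intersection dimensions. The failed
inequality says that `P₁` has smaller codimension in `z_i` than `P₂` in `z_{i+1}`. This lets the
condition `z_{i+1} ≤ P₁` be written as a weighted sum over the hyperplanes of `z_{i+1}` containing
`P₂` (`sum_containmentCoeff`), so the kernel factors through flags whose type has one box moved from
row `i + 1` to row `i`. Hence every invariant kernel is a combination of semistandard orbits modulo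
kernels factoring through strictly more dominant types. Applying this to both factors of a product,
with induction on dominance, shows that the elements `c^ν` span (`mul_mem_cellSpan`).

Linear independence follows by counting. The Robinson–Schensted–Knuth correspondence, written as a
growth diagram, injects pairs of permissible orbits of equal shape into the orbits on `X_μ × X_μ`
(`card_permOrbit_pairs_le`). Orbit indicators are independent, so the spanning family has at most as
many members as the dimension.

The anti-involution is transposition of kernels. The multiplication rule comes from straightening
the left factor of `a ∘ c^ν` alone: its semistandard coefficients do not involve `Ω₂`, and the
remainder factors through more dominant types. -/

open Module

namespace FlagHecke

/-! ### Relative position of two filtrations. -/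

section Adapted

variable {k V : Type*} [Field k] [AddCommGroup V] [Module k V] [FiniteDimensional k V]

/-- The dimension of `z_i ∩ x_j`. -/
noncomputable def interDim (z x : ℕ → Submodule k V) (i j : ℕ) : ℕ :=
  finrank k ↥(z i ⊓ x j)

/-- The combination of intersection dimensions giving the entries of the intersection matrix. -/
def mixedDiff (d : ℕ → ℕ → ℕ) (i j : ℕ) : ℕ :=
  d i j + d (i + 1) (j + 1) - (d i (j + 1) + d (i + 1) j)

lemma finrank_sup_inter {z x : ℕ → Submodule k V} (hz : Antitone z) (hx : Antitone x) (i j : ℕ) :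
    finrank k ↥((z i ⊓ x (j + 1)) ⊔ (z (i + 1) ⊓ x j)) + interDim z x (i + 1) (j + 1) =
      interDim z x i (j + 1) + interDim z x (i + 1) j := by
  have h := Submodule.finrank_sup_add_finrank_inf_eq (z i ⊓ x (j + 1)) (z (i + 1) ⊓ x j)
  have e : (z i ⊓ x (j + 1)) ⊓ (z (i + 1) ⊓ x j) = z (i + 1) ⊓ x (j + 1) := by
    apply le_antisymm
    · exact le_inf (inf_le_right.trans inf_le_left) (inf_le_left.trans inf_le_right)
    · exact le_inf (inf_le_inf_right _ (hz (Nat.le_succ i)))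
        (inf_le_inf_left _ (hx (Nat.le_succ j)))
  rw [e] at h
  exact h

omit [FiniteDimensional k V] in
lemma sup_inter_le {z x : ℕ → Submodule k V} (hz : Antitone z) (hx : Antitone x) (i j : ℕ) :
    (z i ⊓ x (j + 1)) ⊔ (z (i + 1) ⊓ x j) ≤ z i ⊓ x j :=
  sup_le (inf_le_inf_left _ (hx (Nat.le_succ j))) (inf_le_inf_right _ (hz (Nat.le_succ i)))

/-- The truncated subtraction in `mixedDiff` is exact here: `z_i ∩ x_{j+1} + z_{i+1} ∩ x_j` lies in
`z_i ∩ x_j`, and its dimension is given by `finrank_sup_inter`. -/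
lemma mixedDiff_add {z x : ℕ → Submodule k V} (hz : Antitone z) (hx : Antitone x) (i j : ℕ) :
    mixedDiff (interDim z x) i j + interDim z x i (j + 1) + interDim z x (i + 1) j =
      interDim z x i j + interDim z x (i + 1) (j + 1) := by
  have h1 := finrank_sup_inter hz hx i j
  have h2 := Submodule.finrank_mono (sup_inter_le hz hx i j)
  have h3 : finrank k ↥(z i ⊓ x j) = interDim z x i j := rfl
  unfold mixedDiff
  omega

lemma sum_mixedDiff {z x : ℕ → Submodule k V} (hz : Antitone z) (hx : Antitone x) (i j : ℕ) :
    (∑ t ∈ Finset.range j, mixedDiff (interDim z x) i t) + interDim z x i j +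
      interDim z x (i + 1) 0 = interDim z x i 0 + interDim z x (i + 1) j := by
  induction j with
  | zero => simp
  | succ j ih =>
    have := mixedDiff_add hz hx i j
    rw [Finset.sum_range_succ]
    omega

lemma sum_sum_mixedDiff {z x : ℕ → Submodule k V} (hz : Antitone z) (hx : Antitone x) {L : ℕ}
    (hzL : z L = ⊥) (hxL : x L = ⊥) :
    ∑ i ∈ Finset.range L, ∑ j ∈ Finset.range L, mixedDiff (interDim z x) i j =
      interDim z x 0 0 := by
  have hL : ∀ i, interDim z x i L = 0 := fun i => by simp [interDim, hxL]
  have key : ∀ i, (∑ t ∈ Finset.range i, ∑ j ∈ Finset.range L, mixedDiff (interDim z x) t j) +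
      interDim z x i 0 = interDim z x 0 0 := by
    intro i
    induction i with
    | zero => simp
    | succ i ih =>
      have := sum_mixedDiff hz hx i L
      rw [hL, hL] at this
      rw [Finset.sum_range_succ]
      omega
  have := key L
  have h0 : interDim z x L 0 = 0 := by simp [interDim, hzL]
  omega

/-- Two filtrations have a common adapted basis. -/
theorem exists_adapted_basis {z x : ℕ → Submodule k V} (hz : Antitone z) (hx : Antitone x) {L : ℕ}
    (hz0 : z 0 = ⊤) (hx0 : x 0 = ⊤) (hzL : z L = ⊥) (hxL : x L = ⊥) :
    ∃ b : Basis (Σ p : Fin L × Fin L, Fin (mixedDiff (interDim z x) p.1 p.2)) k V,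
      ∀ i j, Submodule.span k (b '' {s | i ≤ (s.1.1 : ℕ) ∧ j ≤ (s.1.2 : ℕ)}) = z i ⊓ x j := by
  have hE : ∀ i j, ∃ v : Fin (mixedDiff (interDim z x) i j) → V,
      Submodule.span k (Set.range v) ⊔ ((z i ⊓ x (j + 1)) ⊔ (z (i + 1) ⊓ x j)) = z i ⊓ x j := by
    intro i j
    obtain ⟨E, hE1, hE2⟩ := IsModularLattice.exists_disjoint_and_sup_eq (sup_inter_le hz hx i j)
    have hr : finrank k E = mixedDiff (interDim z x) i j := by
      have h1 := Submodule.finrank_sup_add_finrank_inf_eq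
        ((z i ⊓ x (j + 1)) ⊔ (z (i + 1) ⊓ x j)) E
      rw [hE2, hE1.eq_bot, finrank_bot] at h1
      have h2 := finrank_sup_inter hz hx i j
      have h3 := mixedDiff_add hz hx i j
      have h4 : finrank k ↥(z i ⊓ x j) = interDim z x i j := rfl
      omega
    let e := finBasisOfFinrankEq k E hr
    refine ⟨fun t => (e t : V), ?_⟩
    have : Set.range (fun t => (e t : V)) = E.subtype '' Set.range e := by
      rw [← Set.range_comp]; rfl
    rw [this, ← Submodule.map_span, e.span_eq, Submodule.map_top, Submodule.range_subtype,
      sup_comm, hE2]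
  choose v hv using hE
  set w : (Σ p : Fin L × Fin L, Fin (mixedDiff (interDim z x) p.1 p.2)) → V :=
    fun s => v s.1.1 s.1.2 s.2 with hw
  have base : ∀ i j, L ≤ i ∨ L ≤ j →
      Submodule.span k (w '' {s | i ≤ (s.1.1 : ℕ) ∧ j ≤ (s.1.2 : ℕ)}) = z i ⊓ x j := by
    intro i j hij
    have h1 : {s : Σ p : Fin L × Fin L, Fin (mixedDiff (interDim z x) p.1 p.2) |
        i ≤ (s.1.1 : ℕ) ∧ j ≤ (s.1.2 : ℕ)} = ∅ := by
      ext s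
      have := s.1.1.2
      have := s.1.2.2
      simp only [Set.mem_ofPred_eq, Set.mem_empty_iff_false, iff_false]
      omega
    rw [h1, Set.image_empty, Submodule.span_empty]
    rcases hij with h | h
    · rw [eq_bot_iff.mpr ((hz h).trans_eq hzL), bot_inf_eq]
    · rw [eq_bot_iff.mpr ((hx h).trans_eq hxL), inf_bot_eq]
  -- Descending induction from the vanishing corner: the vectors at `(i, j)` supplement the spans
  -- already known at `(i, j + 1)` and `(i + 1, j)`.
  have hspan : ∀ N i j, (L - i) + (L - j) ≤ N →
      Submodule.span k (w '' {s | i ≤ (s.1.1 : ℕ) ∧ j ≤ (s.1.2 : ℕ)}) = z i ⊓ x j := by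
    intro N
    induction N with
    | zero => exact fun i j h => base i j (by omega)
    | succ N ih =>
      intro i j h
      by_cases hij : L ≤ i ∨ L ≤ j
      · exact base i j hij
      push Not at hij
      have h1 := ih i (j + 1) (by omega)
      have h2 := ih (i + 1) j (by omega)
      rw [← hv i j, ← h1, ← h2, ← Submodule.span_union, ← Submodule.span_union]
      congr 1
      ext y
      simp only [Set.mem_image, Set.mem_ofPred_eq, Set.mem_union, Set.mem_range]
      constructor
      · rintro ⟨s, ⟨hs1, hs2⟩, rfl⟩
        by_cases hs3 : j + 1 ≤ s.1.2
        · exact Or.inr (Or.inl ⟨s, ⟨hs1, hs3⟩, rfl⟩)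
        by_cases hs4 : i + 1 ≤ s.1.1
        · exact Or.inr (Or.inr ⟨s, ⟨hs4, hs2⟩, rfl⟩)
        left
        obtain ⟨⟨⟨i', hi'⟩, ⟨j', hj'⟩⟩, t⟩ := s
        simp only at hs1 hs2 hs3 hs4
        obtain rfl : i' = i := by omega
        obtain rfl : j' = j := by omega
        exact ⟨t, rfl⟩
      · rintro (⟨t, rfl⟩ | ⟨s, ⟨hs1, hs2⟩, rfl⟩ | ⟨s, ⟨hs1, hs2⟩, rfl⟩)
        · exact ⟨⟨⟨⟨i, hij.1⟩, ⟨j, hij.2⟩⟩, t⟩, ⟨le_rfl, le_rfl⟩, rfl⟩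
        · exact ⟨s, ⟨hs1, by omega⟩, rfl⟩
        · exact ⟨s, ⟨by omega, hs2⟩, rfl⟩
  have hw_top : ⊤ ≤ Submodule.span k (Set.range w) := by
    have := hspan _ 0 0 le_rfl
    simp only [zero_le, and_self, Set.ofPred_true, Set.image_univ, hz0, hx0, inf_top_eq] at this
    exact this.ge
  -- The entries telescope to `dim V`, so the spanning family is a basis and independence needs no
  -- separate argument.
  have hcard : Fintype.card (Σ p : Fin L × Fin L, Fin (mixedDiff (interDim z x) p.1 p.2)) =
      finrank k V := by
    simp only [Fintype.card_sigma, Fintype.card_fin, Fintype.sum_prod_type]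
    rw [← (by rw [interDim, hz0, hx0, inf_top_eq, finrank_top] : interDim z x 0 0 = finrank k V),
      ← sum_sum_mixedDiff hz hx hzL hxL, Finset.sum_range]
    exact Finset.sum_congr rfl fun i _ => (Finset.sum_range _).symm
  refine ⟨basisOfTopLeSpanOfCardEqFinrank w hw_top hcard, fun i j => ?_⟩
  rw [coe_basisOfTopLeSpanOfCardEqFinrank]
  exact hspan _ i j le_rfl

/-- Pairs of filtrations with the same intersection dimensions are conjugate. -/
theorem exists_equiv_of_interDim_eq {z x z' x' : ℕ → Submodule k V} (hz : Antitone z)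
    (hx : Antitone x) (hz' : Antitone z') (hx' : Antitone x') {L : ℕ}
    (hz0 : z 0 = ⊤) (hx0 : x 0 = ⊤) (hzL : z L = ⊥) (hxL : x L = ⊥)
    (hz0' : z' 0 = ⊤) (hx0' : x' 0 = ⊤) (hzL' : z' L = ⊥) (hxL' : x' L = ⊥)
    (h : interDim z x = interDim z' x') :
    ∃ g : V ≃ₗ[k] V, (∀ i, (z i).map (g : V →ₗ[k] V) = z' i) ∧
      ∀ j, (x j).map (g : V →ₗ[k] V) = x' j := by
  obtain ⟨b, hb⟩ := exists_adapted_basis hz hx hz0 hx0 hzL hxL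
  obtain ⟨b', hb'⟩ := h ▸ exists_adapted_basis hz' hx' hz0' hx0' hzL' hxL'
  have key : ∀ i j, (z i ⊓ x j).map (b.equiv b' (Equiv.refl _) : V →ₗ[k] V) = z' i ⊓ x' j := by
    intro i j
    rw [← hb, ← hb', Submodule.map_span, ← Set.image_comp]
    congr 1
    refine Set.image_congr fun s _ => ?_
    simp
  refine ⟨b.equiv b' (Equiv.refl _), fun i => ?_, fun j => ?_⟩
  · simpa [hx0, hx0'] using key i 0
  · simpa [hz0, hz0'] using key 0 j

end Adapted

/-! ### Flags whose type is any composition, since straightening leaves the partitions. -/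

section PFlags

variable {k V : Type*} [Field k] [AddCommGroup V] [Module k V]

/-- A flag whose successive quotients have dimensions prescribed by an arbitrary function `κ`. -/
@[ext]
structure PFlag (k V : Type*) [Field k] [AddCommGroup V] [Module k V] (L : ℕ) (κ : ℕ → ℕ) where
  /-- The subspaces of the flag, from the top downwards. -/
  space : ℕ → Submodule k V
  antitone : Antitone space
  space_zero : space 0 = ⊤
  space_last : space L = ⊥
  finrank_eq : ∀ i, finrank k (space i) = finrank k (space (i + 1)) + κ i

variable {L : ℕ} {κ : ℕ → ℕ}

lemma PFlag.space_eq_bot (z : PFlag k V L κ) {i : ℕ} (hi : L ≤ i) : z.space i = ⊥ :=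
  eq_bot_iff.mpr (z.space_last ▸ z.antitone hi)

instance [Finite V] : Finite (PFlag k V L κ) := by
  have : Finite (Submodule k V) :=
    Finite.of_injective (fun W => (W : Set V)) SetLike.coe_injective
  refine Finite.of_injective
    (fun (x : PFlag k V L κ) (i : Fin L) => x.space i) fun x y h => ?_
  ext1
  funext i
  by_cases hi : i < L
  · exact congrFun h ⟨i, hi⟩
  · rw [x.space_eq_bot (not_lt.mp hi), y.space_eq_bot (not_lt.mp hi)]

noncomputable instance [Finite V] : Fintype (PFlag k V L κ) := Fintype.ofFinite _

instance : MulAction (V ≃ₗ[k] V) (PFlag k V L κ) where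
  smul g x :=
    { space := fun i => (x.space i).map (g : V →ₗ[k] V)
      antitone := fun _ _ h => Submodule.map_mono (x.antitone h)
      space_zero := by rw [x.space_zero, Submodule.map_top, LinearEquiv.range]
      space_last := by rw [x.space_last, Submodule.map_bot]
      finrank_eq := fun i => by
        rw [LinearEquiv.finrank_map_eq, LinearEquiv.finrank_map_eq, x.finrank_eq i] }
  one_smul x := by
    ext1; funext i
    exact Submodule.map_id _
  mul_smul g h x := by
    ext1; funext i
    exact Submodule.map_comp _ _ _

@[simp] lemma PFlag.smul_space (g : V ≃ₗ[k] V) (z : PFlag k V L κ) (i : ℕ) :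
    (g • z).space i = (z.space i).map (g : V →ₗ[k] V) := rfl

/-- The intersection dimensions of two flags. -/
noncomputable def PFlag.dims {κ' : ℕ → ℕ} (z : PFlag k V L κ) (x : PFlag k V L κ') : ℕ → ℕ → ℕ :=
  interDim z.space x.space

lemma PFlag.dims_smul [FiniteDimensional k V] {κ' : ℕ → ℕ} (g : V ≃ₗ[k] V) (z : PFlag k V L κ)
    (x : PFlag k V L κ') : (g • z).dims (g • x) = z.dims x := by
  funext i j
  have h : (g • z).space i ⊓ (g • x).space j = (z.space i ⊓ x.space j).map (g : V →ₗ[k] V) :=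
    (Submodule.map_inf _ g.injective).symm
  unfold PFlag.dims interDim
  rw [h, LinearEquiv.finrank_map_eq]

lemma PFlag.dims_eq_iff [FiniteDimensional k V] {κ' : ℕ → ℕ} {z z' : PFlag k V L κ}
    {x x' : PFlag k V L κ'} :
    z.dims x = z'.dims x' ↔ ∃ g : V ≃ₗ[k] V, g • z = z' ∧ g • x = x' := by
  constructor
  · intro h
    obtain ⟨g, h1, h2⟩ := exists_equiv_of_interDim_eq z.antitone x.antitone z'.antitone x'.antitone
      z.space_zero x.space_zero z.space_last x.space_last z'.space_zero x'.space_zero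
      z'.space_last x'.space_last h
    exact ⟨g, PFlag.ext (funext h1), PFlag.ext (funext h2)⟩
  · rintro ⟨g, rfl, rfl⟩
    rw [PFlag.dims_smul]

lemma PFlag.sum_add_finrank (z : PFlag k V L κ) (i : ℕ) :
    ∑ j ∈ Finset.range i, κ j + finrank k (z.space i) = finrank k V := by
  induction i with
  | zero => rw [z.space_zero, finrank_top]; simp
  | succ i ih => rw [Finset.sum_range_succ]; have := z.finrank_eq i; omega

lemma PFlag.sum_eq (z : PFlag k V L κ) : ∑ j ∈ Finset.range L, κ j = finrank k V := by
  have := z.sum_add_finrank L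
  rwa [z.space_last, finrank_bot, add_zero] at this

lemma PFlag.eq_zero_of_le (z : PFlag k V L κ) {i : ℕ} (hi : L ≤ i) : κ i = 0 := by
  have := z.finrank_eq i
  rw [z.space_eq_bot hi, z.space_eq_bot (hi.trans (Nat.le_succ i))] at this
  omega

end PFlags

/-! ### Counting hyperplanes over a finite field. -/

section Hyperplanes

variable {k V : Type*} [Field k] [AddCommGroup V] [Module k V] [Finite k] [Finite V]

instance : Finite (Submodule k V) :=
  Finite.of_injective (fun W => (W : Set V)) SetLike.coe_injective

noncomputable instance : Fintype (Submodule k V) := Fintype.ofFinite _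

open Classical in
/-- The subspaces of codimension one in `w` which contain `K`. -/
noncomputable def hyperplanes (K w : Submodule k V) : Finset (Submodule k V) :=
  {U | K ≤ U ∧ U ≤ w ∧ finrank k U + 1 = finrank k w}

omit [Finite k] in
lemma mem_hyperplanes {K w U : Submodule k V} :
    U ∈ hyperplanes K w ↔ K ≤ U ∧ U ≤ w ∧ finrank k U + 1 = finrank k w := by
  simp [hyperplanes]

/-- The hyperplanes containing `K` are the kernels of the nonzero functionals vanishing on `K`, and
each one is the kernel of exactly `q - 1` of them. -/
lemma card_hyperplanes_top (K : Submodule k V) :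
    (hyperplanes K ⊤).card * (Nat.card k - 1) + 1 =
      Nat.card k ^ (finrank k V - finrank k K) := by
  classical
  have hfd : FiniteDimensional k V := inferInstance
  have : Finite (Dual k V) := Module.finite_of_finite k
  have := Fintype.ofFinite (Dual k V)
  have hann : ∀ W : Submodule k V, (Finset.univ.filter
      fun f : Dual k V => f ∈ W.dualAnnihilator).card =
      Nat.card k ^ (finrank k V - finrank k W) := by
    intro W
    have h1 : finrank k W.dualAnnihilator = finrank k V - finrank k W := by
      have := Subspace.finrank_add_finrank_dualAnnihilator_eq W
      omega
    rw [← h1, ← Module.natCard_eq_pow_finrank (K := k) (V := W.dualAnnihilator),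
      ← Fintype.card_subtype, Nat.card_eq_fintype_card]
  have hker : ∀ f : Dual k V, f ≠ 0 → finrank k (LinearMap.ker f) + 1 = finrank k V := by
    intro f hf
    have h := Module.Dual.finrank_ker_add_one_of_ne_zero hf
    exact h
  have hmaps : ∀ f ∈ (Finset.univ.filter fun f : Dual k V => f ∈ K.dualAnnihilator).erase 0,
      LinearMap.ker f ∈ hyperplanes K ⊤ := by
    intro f hf
    simp only [Finset.mem_erase, Finset.mem_filter, Finset.mem_univ, true_and,
      Submodule.mem_dualAnnihilator] at hf
    exact mem_hyperplanes.mpr ⟨fun v hv => hf.2 v hv, le_top, by rw [hker f hf.1, finrank_top]⟩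
  have hfib : ∀ U ∈ hyperplanes K ⊤,
      (((Finset.univ.filter fun f : Dual k V => f ∈ K.dualAnnihilator).erase 0).filter
        fun f => LinearMap.ker f = U).card = Nat.card k - 1 := by
    intro U hU
    obtain ⟨h1, -, h2⟩ := mem_hyperplanes.mp hU
    rw [finrank_top] at h2
    have e : (((Finset.univ.filter fun f : Dual k V => f ∈ K.dualAnnihilator).erase 0).filter
        fun f => LinearMap.ker f = U) =
        (Finset.univ.filter fun f : Dual k V => f ∈ U.dualAnnihilator).erase 0 := by
      ext f
      simp only [Finset.mem_erase, Finset.mem_filter, Finset.mem_univ, true_and,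
        Submodule.mem_dualAnnihilator]
      constructor
      · rintro ⟨⟨h3, h4⟩, rfl⟩
        exact ⟨h3, fun v hv => hv⟩
      · rintro ⟨h3, h4⟩
        refine ⟨⟨h3, fun v hv => h4 v (h1 hv)⟩, ?_⟩
        symm
        apply Submodule.eq_of_le_of_finrank_eq
        · exact fun v hv => h4 v hv
        · have := hker f h3
          omega
    rw [e, Finset.card_erase_of_mem (by simp), hann, ← h2]
    simp
  have h := Finset.card_eq_sum_card_fiberwise (f := LinearMap.ker) hmaps
  rw [Finset.sum_congr rfl hfib, Finset.sum_const, smul_eq_mul,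
    Finset.card_erase_of_mem (by simp), hann] at h
  rw [← h]
  have : 0 < Nat.card k ^ (finrank k V - finrank k K) := pow_pos Nat.card_pos _
  omega

lemma card_hyperplanes {K w : Submodule k V} (h : K ≤ w) :
    (hyperplanes K w).card * (Nat.card k - 1) + 1 =
      Nat.card k ^ (finrank k w - finrank k K) := by
  have hK : finrank k (K.submoduleOf w) = finrank k K :=
    (Submodule.submoduleOfEquivOfLe h).finrank_eq
  rw [← hK, ← card_hyperplanes_top]
  congr 2
  symm
  refine Finset.card_bij (fun U _ => U.map w.subtype) ?_ ?_ ?_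
  · intro U hU
    obtain ⟨h1, -, h2⟩ := mem_hyperplanes.mp hU
    refine mem_hyperplanes.mpr ⟨?_, Submodule.map_subtype_le w U, ?_⟩
    · intro v hv
      exact ⟨⟨v, h hv⟩, h1 hv, rfl⟩
    · rw [(Submodule.equivSubtypeMap w U).symm.finrank_eq, h2, finrank_top]
  · intro U _ U' _ e
    exact Submodule.map_injective_of_injective w.injective_subtype e
  · intro U hU
    obtain ⟨h1, h2, h3⟩ := mem_hyperplanes.mp hU
    refine ⟨U.submoduleOf w, mem_hyperplanes.mpr ⟨fun v hv => h1 hv, le_top, ?_⟩, ?_⟩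
    · rw [(Submodule.submoduleOfEquivOfLe h2).finrank_eq, h3, finrank_top]
    · rw [Submodule.submoduleOf, Submodule.map_comap_subtype, inf_eq_right.mpr h2]

variable (k) in
/-- The number of hyperplanes of a `t`-dimensional space. -/
noncomputable def hyperplaneCount (t : ℕ) : ℚ := ((Nat.card k : ℚ) ^ t - 1) / ((Nat.card k : ℚ) - 1)

variable (k) in
lemma one_lt_card : (1 : ℚ) < Nat.card k := by
  exact_mod_cast Finite.one_lt_card (α := k)

variable (k) in
lemma hyperplaneCount_strictMono : StrictMono (hyperplaneCount k) := by
  intro s t h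
  have h1 := one_lt_card k
  have : (Nat.card k : ℚ) ^ s < (Nat.card k : ℚ) ^ t := pow_lt_pow_right₀ h1 h
  unfold hyperplaneCount
  gcongr

lemma card_hyperplanes_eq {K w : Submodule k V} (h : K ≤ w) :
    ((hyperplanes K w).card : ℚ) = hyperplaneCount k (finrank k w - finrank k K) := by
  have h1 := one_lt_card k
  have h2 := card_hyperplanes h
  rw [hyperplaneCount, eq_div_iff (by linarith), eq_sub_iff_add_eq]
  rw [← Nat.cast_one, ← Nat.cast_sub Nat.card_pos]
  exact_mod_cast h2

variable (k) in
/-- The coefficients expressing the condition `w ≤ Y` as a sum over the hyperplanes of `w`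
containing a given subspace of codimension `A`. -/
noncomputable def containmentCoeff (A : ℕ) : ℕ → ℚ
  | 0 => 1 / hyperplaneCount k A
  | t + 1 => -(containmentCoeff A t * hyperplaneCount k (t + 1)) /
      (hyperplaneCount k A - hyperplaneCount k (t + 1))

-- Let `K = w ∩ Y₁` have codimension `t` in `w`, and let `h` be the hyperplane count. Among the `h
-- A` hyperplanes `U` of `w` over `Y₂`, the `h t` containing `K` have `U / (U ∩ Y₁)` of dimension `t
-- - 1`, the others of dimension `t`. The sum is therefore `h t * c (t - 1) + (h A - h t) * c t`,
-- which the recursion for the coefficients makes `0` for `t > 0` and `1` for `t = 0`. The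
-- hypothesis `t < A` keeps the denominator `h A - h t` nonzero.
open Classical in
lemma sum_containmentCoeff {Y₁ Y₂ w : Submodule k V} (h₂ : Y₂ ≤ w) (h₁₂ : Y₂ ≤ Y₁)
    (hlt : finrank k w - finrank k ↥(w ⊓ Y₁) < finrank k w - finrank k Y₂) :
    ∑ U ∈ hyperplanes Y₂ w,
      containmentCoeff k (finrank k w - finrank k Y₂) (finrank k U - finrank k ↥(U ⊓ Y₁)) =
      if w ≤ Y₁ then 1 else 0 := by
  set K := w ⊓ Y₁ with hK
  set A := finrank k w - finrank k Y₂ with hA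
  set t := finrank k w - finrank k K with ht
  have hKw : K ≤ w := inf_le_left
  have hYK : Y₂ ≤ K := le_inf h₂ h₁₂
  have hsub : hyperplanes K w = (hyperplanes Y₂ w).filter (fun U => K ≤ U) := by
    ext U
    simp only [mem_hyperplanes, Finset.mem_filter]
    constructor
    · rintro ⟨a, b, c⟩; exact ⟨⟨hYK.trans a, b, c⟩, a⟩
    · rintro ⟨⟨a, b, c⟩, d⟩; exact ⟨d, b, c⟩
  have hc1 : ((hyperplanes K w).card : ℚ) = hyperplaneCount k t := card_hyperplanes_eq hKw
  have hc2 : ((hyperplanes Y₂ w).card : ℚ) = hyperplaneCount k A := card_hyperplanes_eq h₂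
  have hc3 : (((hyperplanes Y₂ w).filter (fun U => ¬ K ≤ U)).card : ℚ) =
      hyperplaneCount k A - hyperplaneCount k t := by
    rw [← hc1, ← hc2, hsub, eq_sub_iff_add_eq', ← Nat.cast_add,
      Finset.card_filter_add_card_filter_not]
  have hs1 : ∀ U ∈ (hyperplanes Y₂ w).filter (fun U => K ≤ U),
      finrank k U - finrank k ↥(U ⊓ Y₁) = t - 1 ∧ t ≠ 0 := by
    intro U hU
    simp only [Finset.mem_filter, mem_hyperplanes] at hU
    have e : U ⊓ Y₁ = K := le_antisymm (inf_le_inf_right _ hU.1.2.1) (le_inf hU.2 inf_le_right)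
    have := Submodule.finrank_mono hU.2
    rw [e]
    omega
  have hs2 : ∀ U ∈ (hyperplanes Y₂ w).filter (fun U => ¬ K ≤ U),
      finrank k U - finrank k ↥(U ⊓ Y₁) = t := by
    intro U hU
    simp only [Finset.mem_filter, mem_hyperplanes] at hU
    obtain ⟨⟨-, a, b⟩, c⟩ := hU
    have e : U ⊓ Y₁ = U ⊓ K := by rw [hK, ← inf_assoc, inf_eq_left.mpr a]
    have h1 := Submodule.finrank_sup_add_finrank_inf_eq U K
    have h2 : finrank k ↥(U ⊔ K) ≤ finrank k w := Submodule.finrank_mono (sup_le a hKw)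
    have h3 : finrank k U < finrank k ↥(U ⊔ K) :=
      Submodule.finrank_lt_finrank_of_lt (lt_of_le_not_ge le_sup_left
        fun h => c (le_sup_right.trans h))
    have h4 := Submodule.finrank_mono hKw
    rw [e]
    omega
  have hw : w ≤ Y₁ ↔ t = 0 := by
    have h4 := Submodule.finrank_mono hKw
    constructor
    · intro h
      have : K = w := inf_eq_left.mpr h
      rw [ht, this, Nat.sub_self]
    · intro h
      have : K = w := Submodule.eq_of_le_of_finrank_eq hKw (by omega)
      exact inf_eq_left.mp this
  rw [← Finset.sum_filter_add_sum_filter_not _ (fun U => K ≤ U),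
    Finset.sum_congr rfl (fun U hU => by rw [(hs1 U hU).1]),
    Finset.sum_congr (s₁ := (hyperplanes Y₂ w).filter (fun U => ¬ K ≤ U)) rfl
      (fun U hU => by rw [hs2 U hU]),
    Finset.sum_const, Finset.sum_const, nsmul_eq_mul, nsmul_eq_mul, hc3, ← hsub, hc1]
  have hmono := hyperplaneCount_strictMono k hlt
  have h0 : hyperplaneCount k 0 = 0 := by simp [hyperplaneCount]
  simp only [hw]
  rcases t with - | t
  · rw [h0] at hmono
    simp [h0, containmentCoeff, hmono.ne']
  · have : hyperplaneCount k A - hyperplaneCount k (t + 1) ≠ 0 := by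
      exact (sub_pos.mpr hmono).ne'
    simp [containmentCoeff]
    field_simp
    ring

end Hyperplanes

/-! ### Invariant kernels and straightening modulo more dominant types. -/

section Straightening

variable {k V : Type*} [Field k] [AddCommGroup V] [Module k V] [Finite k] [Finite V] {L : ℕ}

variable (k V L) in
/-- The invariant kernels on pairs of flags of types `α` and `β`. -/
def invKer (α β : ℕ → ℕ) : Submodule ℚ (Matrix (PFlag k V L α) (PFlag k V L β) ℚ) where
  carrier := {B | ∀ (g : V ≃ₗ[k] V) z x, B (g • z) (g • x) = B z x}
  add_mem' := fun ha hb g z x => by simp [ha g z x, hb g z x]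
  zero_mem' := fun _ _ _ => rfl
  smul_mem' := fun c _ ha g z x => by simp [ha g z x]

omit [Finite k] in
lemma mul_mem_invKer {α β γ : ℕ → ℕ} {A : Matrix (PFlag k V L α) (PFlag k V L β) ℚ}
    {B : Matrix (PFlag k V L β) (PFlag k V L γ) ℚ} (hA : A ∈ invKer k V L α β)
    (hB : B ∈ invKer k V L β γ) : A * B ∈ invKer k V L α γ := by
  intro g z x
  simp only [Matrix.mul_apply]
  refine (Fintype.sum_equiv (MulAction.toPerm g) _ _ fun y => ?_).symm
  rw [MulAction.toPerm_apply, hA g, hB g]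

omit [Finite k] [Finite V] in
lemma transpose_mem_invKer {α β : ℕ → ℕ} {A : Matrix (PFlag k V L α) (PFlag k V L β) ℚ}
    (hA : A ∈ invKer k V L α β) : A.transpose ∈ invKer k V L β α :=
  fun g z x => hA g x z

open Classical in
/-- The indicator function of the orbit of a pair of flags. -/
noncomputable def orbitKer {α β : ℕ → ℕ} (z₀ : PFlag k V L α) (x₀ : PFlag k V L β) :
    Matrix (PFlag k V L α) (PFlag k V L β) ℚ :=
  Matrix.of fun z x => if z.dims x = z₀.dims x₀ then 1 else 0

open Classical in
omit [Finite k] [Finite V] in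
lemma orbitKer_apply {α β : ℕ → ℕ} (z₀ z : PFlag k V L α) (x₀ x : PFlag k V L β) :
    orbitKer z₀ x₀ z x = if z.dims x = z₀.dims x₀ then 1 else 0 := rfl

omit [Finite k] in
lemma orbitKer_mem_invKer {α β : ℕ → ℕ} (z₀ : PFlag k V L α) (x₀ : PFlag k V L β) :
    orbitKer z₀ x₀ ∈ invKer k V L α β := by
  intro g z x
  rw [orbitKer_apply, orbitKer_apply, PFlag.dims_smul]

omit [Finite k] in
lemma apply_eq_of_dims_eq {α β : ℕ → ℕ} {B : Matrix (PFlag k V L α) (PFlag k V L β) ℚ}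
    (hB : B ∈ invKer k V L α β) {z z' : PFlag k V L α} {x x' : PFlag k V L β}
    (h : z.dims x = z'.dims x') : B z x = B z' x' := by
  obtain ⟨g, rfl, rfl⟩ := PFlag.dims_eq_iff.mp h
  exact (hB g z x).symm

omit [Finite k] in
/-- An invariant kernel is a combination of the orbits contained in its support. -/
lemma mem_span_orbitKer {α β : ℕ → ℕ} {B : Matrix (PFlag k V L α) (PFlag k V L β) ℚ}
    (hB : B ∈ invKer k V L α β) :
    B ∈ Submodule.span ℚ {M | ∃ z x, B z x ≠ 0 ∧ M = orbitKer z x} := by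
  classical
  let T : Finset (ℕ → ℕ → ℕ) :=
    Finset.univ.image fun p : PFlag k V L α × PFlag k V L β => p.1.dims p.2
  let c : (ℕ → ℕ → ℕ) → ℚ := fun d =>
    if h : ∃ p : PFlag k V L α × PFlag k V L β, p.1.dims p.2 = d then
      B h.choose.1 h.choose.2 else 0
  have hc : ∀ z x, c (z.dims x) = B z x := by
    intro z x
    have h : ∃ p : PFlag k V L α × PFlag k V L β, p.1.dims p.2 = z.dims x := ⟨(z, x), rfl⟩
    simp only [c, dif_pos h]
    exact apply_eq_of_dims_eq hB h.choose_spec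
  have e : B = ∑ d ∈ T, c d • (Matrix.of fun z x => if z.dims x = d then 1 else 0 :
      Matrix (PFlag k V L α) (PFlag k V L β) ℚ) := by
    ext z x
    rw [Matrix.sum_apply, Finset.sum_eq_single (z.dims x)]
    · simp [hc]
    · intro d _ hd
      simp [hd.symm]
    · intro h
      exact absurd (Finset.mem_image.mpr ⟨(z, x), Finset.mem_univ _, rfl⟩) h
  suffices h : ∀ d ∈ T, c d • (Matrix.of fun z x => if z.dims x = d then 1 else 0 :
      Matrix (PFlag k V L α) (PFlag k V L β) ℚ) ∈
      Submodule.span ℚ {M | ∃ z x, B z x ≠ 0 ∧ M = orbitKer z x} by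
    have := Submodule.sum_mem _ h
    rwa [← e] at this
  intro d hd
  obtain ⟨⟨z, x⟩, -, rfl⟩ := Finset.mem_image.mp hd
  by_cases h0 : B z x = 0
  · rw [hc, h0, zero_smul]
    exact zero_mem _
  · exact Submodule.smul_mem _ _ (Submodule.subset_span ⟨z, x, h0, rfl⟩)

/-- Semistandardness of a pair of flags, in terms of dimensions. -/
def IsSemistandardPair {α β : ℕ → ℕ} (z : PFlag k V L α) (x : PFlag k V L β) : Prop :=
  -- By `PFlag.codim_sup` the left codimension counts the labels at most `j` in row `i + 1`, the
  -- right one the labels less than `j` in row `i`.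
  ∀ i j, finrank k (z.space (i + 1)) -
      finrank k ↥(z.space (i + 2) ⊔ (z.space (i + 1) ⊓ x.space (j + 1))) ≤
    finrank k (z.space i) - finrank k ↥(z.space (i + 1) ⊔ (z.space i ⊓ x.space j))

/-- Move one box from row `i + 1` to row `i`. -/
def raiseRow (ν : ℕ → ℕ) (i : ℕ) : ℕ → ℕ :=
  Function.update (Function.update ν i (ν i + 1)) (i + 1) (ν (i + 1) - 1)

/-- Replace the `(i + 1)`-st space of a flag by one of its hyperplanes. -/
def PFlag.lower {ν : ℕ → ℕ} (z : PFlag k V L ν) (i : ℕ) (U : Submodule k V)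
    (h₁ : z.space (i + 2) ≤ U) (h₂ : U ≤ z.space (i + 1))
    (h₃ : finrank k U + 1 = finrank k (z.space (i + 1))) : PFlag k V L (raiseRow ν i) where
  space := Function.update z.space (i + 1) U
  antitone := by
    apply antitone_nat_of_succ_le
    intro t
    rcases eq_or_ne t (i + 1) with rfl | h
    · rw [Function.update_self, Function.update_of_ne (by omega)]
      exact h₁
    rcases eq_or_ne t i with rfl | h'
    · rw [Function.update_self, Function.update_of_ne (by omega)]
      exact h₂.trans (z.antitone (Nat.le_succ _))
    · rw [Function.update_of_ne h, Function.update_of_ne (by omega)]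
      exact z.antitone (Nat.le_succ _)
  space_zero := by rw [Function.update_of_ne (by omega), z.space_zero]
  space_last := by
    rcases eq_or_ne L (i + 1) with rfl | h
    · rw [z.space_last, finrank_bot] at h₃
      omega
    · rw [Function.update_of_ne h, z.space_last]
  finrank_eq := by
    intro t
    have e := z.finrank_eq
    have := Submodule.finrank_mono h₁
    rcases eq_or_ne t (i + 1) with rfl | h
    · rw [Function.update_self, Function.update_of_ne (by omega), raiseRow, Function.update_self]
      have := e (i + 1)
      rw [show i + 1 + 1 = i + 2 from rfl] at this ⊢
      omega
    rcases eq_or_ne t i with rfl | h'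
    · rw [Function.update_self, Function.update_of_ne (by omega), raiseRow,
        Function.update_of_ne (by omega), Function.update_self]
      have := e t
      omega
    · rw [Function.update_of_ne h, Function.update_of_ne (by omega), raiseRow,
        Function.update_of_ne h, Function.update_of_ne h']
      exact e t

/-- The conjugates of the configuration `(z₀, x₀, P₀)`, where the space `z₀ (i + 1)` is ignored. -/
def GarnirRel (i : ℕ) (z₀ x₀ : ℕ → Submodule k V) (P₀ : Submodule k V × Submodule k V)
    (z x : ℕ → Submodule k V) (P : Submodule k V × Submodule k V) : Prop :=
  ∃ g : V ≃ₗ[k] V, (∀ t, t ≠ i + 1 → z t = (z₀ t).map (g : V →ₗ[k] V)) ∧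
    (∀ t, x t = (x₀ t).map (g : V →ₗ[k] V)) ∧
    P.1 = P₀.1.map (g : V →ₗ[k] V) ∧ P.2 = P₀.2.map (g : V →ₗ[k] V)

/-- The action of a linear automorphism on pairs of subspaces. -/
def mapPair (g : V ≃ₗ[k] V) : Submodule k V × Submodule k V ≃ Submodule k V × Submodule k V :=
  Equiv.prodCongr (Submodule.orderIsoMapComap g).toEquiv (Submodule.orderIsoMapComap g).toEquiv

omit [Finite k] [Finite V] in
lemma mapPair_fst (g : V ≃ₗ[k] V) (P : Submodule k V × Submodule k V) :
    (mapPair g P).1 = P.1.map (g : V →ₗ[k] V) := rfl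

omit [Finite k] [Finite V] in
lemma mapPair_snd (g : V ≃ₗ[k] V) (P : Submodule k V × Submodule k V) :
    (mapPair g P).2 = P.2.map (g : V →ₗ[k] V) := rfl

omit [Finite k] [Finite V] in
lemma map_le_map_equiv_iff (g : V ≃ₗ[k] V) {U W : Submodule k V} :
    U.map (g : V →ₗ[k] V) ≤ W.map (g : V →ₗ[k] V) ↔ U ≤ W :=
  Submodule.map_le_map_iff_of_injective g.injective _ _

omit [Finite k] [Finite V] in
lemma garnirRel_smul {i : ℕ} {z₀ x₀ : ℕ → Submodule k V} {P₀ : Submodule k V × Submodule k V}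
    (g : V ≃ₗ[k] V) {α β : ℕ → ℕ} (z : PFlag k V L α) (x : PFlag k V L β)
    (P : Submodule k V × Submodule k V) :
    GarnirRel i z₀ x₀ P₀ (g • z).space (g • x).space (mapPair g P) ↔
      GarnirRel i z₀ x₀ P₀ z.space x.space P := by
  have hinj : Function.Injective (Submodule.map (g : V →ₗ[k] V)) :=
    Submodule.map_injective_of_injective g.injective
  have hcomp : ∀ (h : V ≃ₗ[k] V) (U : Submodule k V),
      U.map ((g * h : V ≃ₗ[k] V) : V →ₗ[k] V) = (U.map (h : V →ₗ[k] V)).map (g : V →ₗ[k] V) :=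
    fun h U => Submodule.map_comp _ _ _
  constructor
  · rintro ⟨h, h1, h2, h3, h4⟩
    have hh : h = g * (g⁻¹ * h) := by group
    rw [hh] at h1 h2 h3 h4
    refine ⟨g⁻¹ * h, fun t ht => hinj ?_, fun t => hinj ?_, hinj ?_, hinj ?_⟩
    · rw [← hcomp]; exact h1 t ht
    · rw [← hcomp]; exact h2 t
    · rw [← hcomp]; exact h3
    · rw [← hcomp]; exact h4
  · rintro ⟨h, h1, h2, h3, h4⟩
    refine ⟨g * h, fun t ht => ?_, fun t => ?_, ?_, ?_⟩
    · rw [hcomp, ← h1 t ht]; rfl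
    · rw [hcomp, ← h2 t]; rfl
    · rw [hcomp, ← h3]; rfl
    · rw [hcomp, ← h4]; rfl

open Classical in
/-- The kernel obtained by summing over all conjugates of a configuration a function of the
configuration and the space `z (i + 1)`. -/
noncomputable def garnirSum (i : ℕ) (z₀ x₀ : ℕ → Submodule k V)
    (P₀ : Submodule k V × Submodule k V)
    (f : Submodule k V → Submodule k V × Submodule k V → ℚ) (α β : ℕ → ℕ) :
    Matrix (PFlag k V L α) (PFlag k V L β) ℚ :=
  Matrix.of fun z x => ∑ P : Submodule k V × Submodule k V with GarnirRel i z₀ x₀ P₀ z.space x.space P,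
    f (z.space (i + 1)) P

omit [Finite k] in
lemma garnirSum_mem_invKer (i : ℕ) (z₀ x₀ : ℕ → Submodule k V)
    (P₀ : Submodule k V × Submodule k V)
    {f : Submodule k V → Submodule k V × Submodule k V → ℚ}
    (hf : ∀ (g : V ≃ₗ[k] V) U P, f (U.map (g : V →ₗ[k] V)) (mapPair g P) = f U P) (α β : ℕ → ℕ) :
    garnirSum (L := L) i z₀ x₀ P₀ f α β ∈ invKer k V L α β := by
  intro g z x
  simp only [garnirSum, Matrix.of_apply]
  symm
  refine Finset.sum_equiv (mapPair g) (fun P => ?_) (fun P _ => ?_)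
  · simp only [Finset.mem_filter, Finset.mem_univ, true_and, garnirRel_smul]
  · rw [PFlag.smul_space, hf]

variable (k V L) in
open Classical in
/-- The incidence kernel between flags differing in a hyperplane of the `(i + 1)`-st space. -/
noncomputable def lowerKer (ν : ℕ → ℕ) (i : ℕ) :
    Matrix (PFlag k V L ν) (PFlag k V L (raiseRow ν i)) ℚ :=
  Matrix.of fun z z' => if (∀ t, t ≠ i + 1 → z'.space t = z.space t) ∧
    z'.space (i + 1) ≤ z.space (i + 1) then 1 else 0

omit [Finite k] [Finite V] in
lemma lowerKer_mem_invKer (ν : ℕ → ℕ) (i : ℕ) :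
    lowerKer k V L ν i ∈ invKer k V L ν (raiseRow ν i) := by
  intro g z z'
  have hinj : Function.Injective (Submodule.map (g : V →ₗ[k] V)) :=
    Submodule.map_injective_of_injective g.injective
  classical exact if_congr (by simp only [PFlag.smul_space, hinj.eq_iff, map_le_map_equiv_iff]) rfl rfl

/-- The products of invariant kernels which factor through a flag variety of type `raiseRow ν i`. -/
def raisedProducts (ν ξ : ℕ → ℕ) : Set (Matrix (PFlag k V L ν) (PFlag k V L ξ) ℚ) :=
  {M | ∃ i, 0 < ν (i + 1) ∧ ∃ A ∈ invKer k V L ν (raiseRow ν i),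
    ∃ B ∈ invKer k V L (raiseRow ν i) ξ, M = A * B}

/-! ### The Garnir kernel and its factorization. -/

section Garnir

variable {ν ξ : ℕ → ℕ} (z₀ : PFlag k V L ν) (x₀ : PFlag k V L ξ) (i j : ℕ)

/-- The upper and the lower space of the Garnir configuration of `(z₀, x₀)` at `(i, j)`. -/
def garnirPair : Submodule k V × Submodule k V :=
  (z₀.space (i + 1) ⊔ (z₀.space i ⊓ x₀.space j),
    z₀.space (i + 2) ⊔ (z₀.space (i + 1) ⊓ x₀.space (j + 1)))

open Classical in
/-- The number of conjugates of the Garnir configuration compatible with a pair of flags. -/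
noncomputable def garnirKer : Matrix (PFlag k V L ν) (PFlag k V L ξ) ℚ :=
  garnirSum i z₀.space x₀.space (garnirPair z₀ x₀ i j)
    (fun U P => if P.2 ≤ U ∧ U ≤ P.1 then 1 else 0) ν ξ

omit [Finite k] in
lemma garnirKer_mem_invKer : garnirKer z₀ x₀ i j ∈ invKer k V L ν ξ := by
  apply garnirSum_mem_invKer
  intro g U P
  classical exact if_congr (by simp only [mapPair_fst, mapPair_snd, map_le_map_equiv_iff]) rfl rfl

-- Only the original configuration contributes. A conjugate fixing `x₀` and all `z₀ t` with `t ≠ i +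
-- 1` has `P.1` containing `z₀ i ∩ x₀ j`; if also `z₀ (i + 1) ≤ P.1`, then `P.1` contains the
-- original upper space, and the dimensions agree. Dually, `P.2 ≤ z₀ (i + 1)` forces `P.2` into the
-- original lower space.
omit [Finite k] in
lemma garnirKer_apply_self : garnirKer z₀ x₀ i j z₀ x₀ = 1 := by
  classical
  simp only [garnirKer, garnirSum, Matrix.of_apply]
  rw [Finset.sum_eq_single (garnirPair z₀ x₀ i j)]
  · rw [if_pos]
    exact ⟨sup_le (z₀.antitone (Nat.le_succ _)) inf_le_left, le_sup_left⟩
  · intro P hP hne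
    rw [if_neg]
    rintro ⟨h1, h2⟩
    apply hne
    obtain ⟨g, hg1, hg2, hg3, hg4⟩ := (Finset.mem_filter.mp hP).2
    have hfd : FiniteDimensional k V := inferInstance
    refine Prod.ext ?_ ?_
    · symm
      apply Submodule.eq_of_le_of_finrank_eq
      · refine sup_le h2 ?_
        rw [hg3, hg1 i (by omega), hg2 j, ← Submodule.map_inf _ g.injective]
        exact Submodule.map_mono le_sup_right
      · rw [hg3, LinearEquiv.finrank_map_eq]
    · apply Submodule.eq_of_le_of_finrank_eq
      · have e : P.2 = z₀.space (i + 2) ⊔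
            ((z₀.space (i + 1)).map (g : V →ₗ[k] V) ⊓ x₀.space (j + 1)) := by
          rw [hg4, hg2 (j + 1), hg1 (i + 2) (by omega), ← Submodule.map_inf _ g.injective,
            ← Submodule.map_sup]
          rfl
        have h3 : (z₀.space (i + 1)).map (g : V →ₗ[k] V) ⊓ x₀.space (j + 1) ≤
            z₀.space (i + 1) := by
          refine le_trans ?_ h1
          rw [e]
          exact le_sup_right
        rw [e]
        exact sup_le_sup_left (le_inf h3 inf_le_right) _
      · rw [hg4, LinearEquiv.finrank_map_eq]
  · intro h
    exact absurd (Finset.mem_filter.mpr ⟨Finset.mem_univ _, 1, fun t _ => (Submodule.map_id _).symm,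
      fun t => (Submodule.map_id _).symm, (Submodule.map_id _).symm, (Submodule.map_id _).symm⟩) h

omit [Finite k] [Finite V] in
lemma PFlag.finrank_space_eq (z z' : PFlag k V L ν) (t : ℕ) :
    finrank k (z.space t) = finrank k (z'.space t) := by
  have := z.sum_add_finrank t
  have := z'.sum_add_finrank t
  omega

-- This gives the triangularity behind straightening. Only the space with index `i + 1` can change
-- position. For `t ≥ j + 1` its intersection with `x t` is bounded below through `P.2`. For `t ≤ j`
-- the bound `z (i + 1) ≤ P.1` limits the sum of `z (i + 1)` and `z i ∩ x t` from above, hence their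
-- intersection from below.
omit [Finite k] in
lemma dims_le_of_garnirKer_ne_zero {z : PFlag k V L ν} {x : PFlag k V L ξ}
    (h : garnirKer z₀ x₀ i j z x ≠ 0) (s t : ℕ) : z₀.dims x₀ s t ≤ z.dims x s t := by
  classical
  have hfd : FiniteDimensional k V := inferInstance
  simp only [garnirKer, garnirSum, Matrix.of_apply] at h
  obtain ⟨P, hP, hP'⟩ := Finset.exists_ne_zero_of_sum_ne_zero h
  obtain ⟨g, hg1, hg2, hg3, hg4⟩ := (Finset.mem_filter.mp hP).2
  obtain ⟨h1, h2⟩ : P.2 ≤ z.space (i + 1) ∧ z.space (i + 1) ≤ P.1 := by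
    by_contra hc
    exact hP' (if_neg hc)
  have mapinf : ∀ U W : Submodule k V, finrank k ↥(U.map (g : V →ₗ[k] V) ⊓ W.map (g : V →ₗ[k] V)) =
      finrank k ↥(U ⊓ W) := by
    intro U W
    rw [← Submodule.map_inf _ g.injective, LinearEquiv.finrank_map_eq]
  unfold PFlag.dims interDim
  by_cases hs : s = i + 1
  · subst hs
    by_cases ht : j + 1 ≤ t
    · rw [← mapinf, ← hg2 t]
      apply Submodule.finrank_mono
      refine le_inf ?_ inf_le_right
      refine le_trans ?_ h1
      rw [hg4, hg2 t, ← Submodule.map_inf _ g.injective]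
      apply Submodule.map_mono
      exact le_trans (inf_le_inf_left _ (x₀.antitone ht)) le_sup_right
    · have e : ∀ (y : PFlag k V L ν) (v : PFlag k V L ξ), y.space (i + 1) ⊓ v.space t =
          y.space (i + 1) ⊓ (y.space i ⊓ v.space t) := by
        intro y v
        rw [← inf_assoc, inf_eq_left.mpr (y.antitone (Nat.le_succ i))]
      rw [e z x, e z₀ x₀]
      have f1 := Submodule.finrank_sup_add_finrank_inf_eq (z.space (i + 1))
        (z.space i ⊓ x.space t)
      have f2 := Submodule.finrank_sup_add_finrank_inf_eq (z₀.space (i + 1))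
        (z₀.space i ⊓ x₀.space t)
      have f3 := PFlag.finrank_space_eq z z₀ (i + 1)
      have f4 : finrank k ↥(z.space i ⊓ x.space t) = finrank k ↥(z₀.space i ⊓ x₀.space t) := by
        rw [hg1 i (by omega), hg2 t, mapinf]
      have f5 : finrank k ↥(z.space (i + 1) ⊔ (z.space i ⊓ x.space t)) ≤
          finrank k ↥(z₀.space (i + 1) ⊔ (z₀.space i ⊓ x₀.space t)) := by
        rw [← LinearEquiv.finrank_map_eq g (z₀.space (i + 1) ⊔ (z₀.space i ⊓ x₀.space t))]
        apply Submodule.finrank_mono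
        rw [hg1 i (by omega), hg2 t, ← Submodule.map_inf _ g.injective]
        refine sup_le (h2.trans ?_) (Submodule.map_mono le_sup_right)
        rw [hg3]
        exact Submodule.map_mono (sup_le_sup_left (inf_le_inf_left _ (x₀.antitone (by omega))) _)
      omega
  · rw [hg1 s hs, hg2 t, mapinf]

open Classical in
/-- The second factor of the Garnir kernel. -/
noncomputable def garnirFactor : Matrix (PFlag k V L (raiseRow ν i)) (PFlag k V L ξ) ℚ :=
  garnirSum i z₀.space x₀.space (garnirPair z₀ x₀ i j)
    (fun U P => if P.2 ≤ U then
      containmentCoeff k (finrank k (z₀.space (i + 1)) - finrank k (garnirPair z₀ x₀ i j).2)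
        (finrank k U - finrank k ↥(U ⊓ P.1)) else 0) (raiseRow ν i) ξ

omit [Finite k] in
lemma garnirFactor_mem_invKer : garnirFactor z₀ x₀ i j ∈ invKer k V L (raiseRow ν i) ξ := by
  apply garnirSum_mem_invKer
  intro g U P
  classical
  refine if_congr (by simp only [mapPair_snd, map_le_map_equiv_iff]) ?_ rfl
  rw [mapPair_fst, ← Submodule.map_inf _ g.injective, LinearEquiv.finrank_map_eq,
    LinearEquiv.finrank_map_eq]

-- A flag `z'` incident to `z` is the same as a hyperplane of `z (i + 1)` containing `z (i + 2)`, by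
-- `PFlag.lower`; requiring `Y ≤ U` implies the latter containment.
open Classical in
omit [Finite k] in
lemma sum_lowerKer (z : PFlag k V L ν) {Y : Submodule k V} (hY : z.space (i + 2) ≤ Y)
    (f : Submodule k V → ℚ) :
    ∑ z' : PFlag k V L (raiseRow ν i), lowerKer k V L ν i z z' *
      (if Y ≤ z'.space (i + 1) then f (z'.space (i + 1)) else 0) =
      ∑ U ∈ hyperplanes Y (z.space (i + 1)), f U := by
  have hfd : FiniteDimensional k V := inferInstance
  have e : ∀ z' : PFlag k V L (raiseRow ν i), lowerKer k V L ν i z z' *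
      (if Y ≤ z'.space (i + 1) then f (z'.space (i + 1)) else 0) =
      if ((∀ t, t ≠ i + 1 → z'.space t = z.space t) ∧ z'.space (i + 1) ≤ z.space (i + 1)) ∧
        Y ≤ z'.space (i + 1) then f (z'.space (i + 1)) else 0 := by
    intro z'
    rw [lowerKer, Matrix.of_apply, ite_and]
    split_ifs <;> simp_all
  rw [Finset.sum_congr rfl fun z' _ => e z', ← Finset.sum_filter]
  refine Finset.sum_bij' (fun z' _ => z'.space (i + 1))
    (fun U hU => z.lower i U (hY.trans (mem_hyperplanes.mp hU).1) (mem_hyperplanes.mp hU).2.1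
      (mem_hyperplanes.mp hU).2.2) ?_ ?_ ?_ ?_ fun _ _ => rfl
  · intro z' hz'
    obtain ⟨-, ⟨h1, h2⟩, h3⟩ := Finset.mem_filter.mp hz'
    refine mem_hyperplanes.mpr ⟨h3, h2, ?_⟩
    have f1 := z.finrank_eq i
    have f2 := z'.finrank_eq i
    have f3 : raiseRow ν i i = ν i + 1 := by
      rw [raiseRow, Function.update_of_ne (by omega), Function.update_self]
    rw [h1 i (by omega), f3] at f2
    omega
  · intro U hU
    obtain ⟨h1, h2, h3⟩ := mem_hyperplanes.mp hU
    refine Finset.mem_filter.mpr ⟨Finset.mem_univ _, ⟨fun t ht => ?_, ?_⟩, ?_⟩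
    · exact Function.update_of_ne ht _ _
    · exact (Function.update_self (i + 1) U z.space).trans_le h2
    · exact h1.trans_eq (Function.update_self (i + 1) U z.space).symm
  · intro z' hz'
    obtain ⟨-, ⟨h1, h2⟩, h3⟩ := Finset.mem_filter.mp hz'
    ext1
    funext t
    change Function.update z.space (i + 1) (z'.space (i + 1)) t = _
    by_cases ht : t = i + 1
    · subst ht; simp
    · rw [Function.update_of_ne ht, h1 t ht]
  · intro U hU
    exact Function.update_self (i + 1) U z.space

/-- The configurations `P` compatible with `z` do not see `z (i + 1)`, so they are the same for
every `z'` incident to `z` and the two sums can be exchanged. For fixed `P` the inner sum over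
hyperplanes is evaluated by `sum_containmentCoeff`. Its strict inequality follows from `hlt`,
because the codimension of `z (i + 1) ∩ P.1` in `z (i + 1)` is at most that of `P.1` in `z i`. -/
lemma garnirKer_eq_mul
    (hlt : finrank k (z₀.space i) - finrank k (garnirPair z₀ x₀ i j).1 <
      finrank k (z₀.space (i + 1)) - finrank k (garnirPair z₀ x₀ i j).2) :
    garnirKer z₀ x₀ i j = lowerKer k V L ν i * garnirFactor z₀ x₀ i j := by
  classical
  have hfd : FiniteDimensional k V := inferInstance
  ext z x
  have hrel : ∀ z' : PFlag k V L (raiseRow ν i), ∀ P, lowerKer k V L ν i z z' ≠ 0 →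
      (GarnirRel i z₀.space x₀.space (garnirPair z₀ x₀ i j) z'.space x.space P ↔
        GarnirRel i z₀.space x₀.space (garnirPair z₀ x₀ i j) z.space x.space P) := by
    intro z' P h
    have h' : ∀ t, t ≠ i + 1 → z'.space t = z.space t := by
      by_contra hc
      exact h (if_neg fun h'' => hc h''.1)
    unfold GarnirRel
    refine exists_congr fun g => and_congr_left' (forall_congr' fun t => ?_)
    refine imp_congr_right fun ht => ?_
    rw [h' t ht]
  simp only [Matrix.mul_apply, garnirFactor, garnirKer, garnirSum, Matrix.of_apply]
  have e : ∀ z' : PFlag k V L (raiseRow ν i), ∀ F : Submodule k V × Submodule k V → ℚ,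
      lowerKer k V L ν i z z' * ∑ P with
        GarnirRel i z₀.space x₀.space (garnirPair z₀ x₀ i j) z'.space x.space P, F P =
      ∑ P with GarnirRel i z₀.space x₀.space (garnirPair z₀ x₀ i j) z.space x.space P,
        lowerKer k V L ν i z z' * F P := by
    intro z' F
    by_cases h : lowerKer k V L ν i z z' = 0
    · simp [h]
    · simp only [hrel z' _ h, Finset.mul_sum]
  simp only [e]
  rw [Finset.sum_comm]
  refine Finset.sum_congr rfl fun P hP => ?_
  obtain ⟨g, hg1, hg2, hg3, hg4⟩ := (Finset.mem_filter.mp hP).2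
  have hY : z.space (i + 2) ≤ P.2 := by
    rw [hg1 _ (by omega), hg4]
    exact Submodule.map_mono le_sup_left
  have h12 : P.2 ≤ P.1 := by
    rw [hg3, hg4]
    exact Submodule.map_mono ((sup_le (z₀.antitone (Nat.le_succ _)) inf_le_left).trans le_sup_left)
  have h1 : P.1 ≤ z.space i := by
    rw [hg3, hg1 _ (by omega)]
    exact Submodule.map_mono (sup_le (z₀.antitone (Nat.le_succ _)) inf_le_left)
  rw [sum_lowerKer i z hY fun U => containmentCoeff k
    (finrank k (z₀.space (i + 1)) - finrank k (garnirPair z₀ x₀ i j).2)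
        (finrank k U - finrank k ↥(U ⊓ P.1))]
  have f1 := PFlag.finrank_space_eq z z₀ (i + 1)
  have f2 := PFlag.finrank_space_eq z z₀ i
  have f3 : finrank k P.1 = finrank k (garnirPair z₀ x₀ i j).1 := by
    rw [hg3, LinearEquiv.finrank_map_eq]
  have f4 : finrank k P.2 = finrank k (garnirPair z₀ x₀ i j).2 := by
    rw [hg4, LinearEquiv.finrank_map_eq]
  by_cases h : P.2 ≤ z.space (i + 1)
  · rw [← f4, ← f1, sum_containmentCoeff h h12]
    · simp [h]
    · have f5 := Submodule.finrank_sup_add_finrank_inf_eq (z.space (i + 1)) P.1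
      have f6 : finrank k ↥(z.space (i + 1) ⊔ P.1) ≤ finrank k (z.space i) :=
        Submodule.finrank_mono (sup_le (z.antitone (Nat.le_succ i)) h1)
      omega
  · rw [if_neg (fun h' => h h'.1), Finset.sum_eq_zero]
    intro U hU
    obtain ⟨a, b, -⟩ := mem_hyperplanes.mp hU
    exact absurd (a.trans b) h

/-- The sum of all intersection dimensions of a pair of flags. -/
noncomputable def totalDim {α β : ℕ → ℕ} (z : PFlag k V L α) (x : PFlag k V L β) : ℕ :=
  ∑ s ∈ Finset.range L, ∑ t ∈ Finset.range L, z.dims x s t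

omit [Finite k] in
lemma totalDim_le {α β : ℕ → ℕ} (z : PFlag k V L α) (x : PFlag k V L β) :
    totalDim z x ≤ L * (L * finrank k V) := by
  have hfd : FiniteDimensional k V := inferInstance
  calc totalDim z x ≤ ∑ _s ∈ Finset.range L, ∑ _t ∈ Finset.range L, finrank k V :=
        Finset.sum_le_sum fun s _ => Finset.sum_le_sum fun t _ => Submodule.finrank_le _
    _ = _ := by simp

omit [Finite k] in
lemma totalDim_lt {α β : ℕ → ℕ} {z z' : PFlag k V L α} {x x' : PFlag k V L β}
    (hle : ∀ s t, z.dims x s t ≤ z'.dims x' s t) (hne : z'.dims x' ≠ z.dims x) :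
    totalDim z x < totalDim z' x' := by
  have hfd : FiniteDimensional k V := inferInstance
  obtain ⟨s, t, hst⟩ : ∃ s t, z.dims x s t < z'.dims x' s t := by
    by_contra hc
    push Not at hc
    exact hne (funext fun s => funext fun t => le_antisymm (hc s t) (hle s t))
  have hs : s < L := by
    by_contra hc
    have : z'.dims x' s t = 0 := by
      rw [PFlag.dims, interDim, z'.space_eq_bot (not_lt.mp hc), bot_inf_eq, finrank_bot]
    omega
  have ht : t < L := by
    by_contra hc
    have : z'.dims x' s t = 0 := by
      rw [PFlag.dims, interDim, x'.space_eq_bot (not_lt.mp hc), inf_bot_eq, finrank_bot]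
    omega
  exact Finset.sum_lt_sum (fun s _ => Finset.sum_le_sum fun t _ => hle s t)
    ⟨s, Finset.mem_range.mpr hs, Finset.sum_lt_sum (fun t _ => hle s t)
      ⟨t, Finset.mem_range.mpr ht, hst⟩⟩

/-- Induction on how far the total intersection dimension is from its upper bound. At a violation
the Garnir kernel is a raised product, and subtracting the orbit itself leaves only orbits of
strictly larger total dimension. -/
lemma orbitKer_mem_span (z₀ : PFlag k V L ν) (x₀ : PFlag k V L ξ) :
    orbitKer z₀ x₀ ∈ Submodule.span ℚ
      ({M | ∃ z x, IsSemistandardPair z x ∧ M = orbitKer z x} ∪ raisedProducts ν ξ) := by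
  have hfd : FiniteDimensional k V := inferInstance
  induction hN : L * (L * finrank k V) - totalDim z₀ x₀ using Nat.strong_induction_on
    generalizing z₀ x₀ with
  | _ N ih =>
  by_cases hss : IsSemistandardPair z₀ x₀
  · exact Submodule.subset_span (Or.inl ⟨z₀, x₀, hss, rfl⟩)
  obtain ⟨i, j, hij⟩ : ∃ i j, finrank k (z₀.space i) - finrank k (garnirPair z₀ x₀ i j).1 <
      finrank k (z₀.space (i + 1)) - finrank k (garnirPair z₀ x₀ i j).2 := by
    unfold IsSemistandardPair at hss
    push Not at hss
    exact hss
  have h1 : garnirKer z₀ x₀ i j ∈ Submodule.span ℚ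
      ({M | ∃ z x, IsSemistandardPair z x ∧ M = orbitKer z x} ∪ raisedProducts ν ξ) := by
    refine Submodule.subset_span (Or.inr ⟨i, ?_, _, lowerKer_mem_invKer ν i, _,
      garnirFactor_mem_invKer z₀ x₀ i j, garnirKer_eq_mul z₀ x₀ i j hij⟩)
    have f1 := z₀.finrank_eq (i + 1)
    have f2 : finrank k (z₀.space (i + 2)) ≤ finrank k (garnirPair z₀ x₀ i j).2 :=
      Submodule.finrank_mono le_sup_left
    have f3 : finrank k (z₀.space (i + 1 + 1)) = finrank k (z₀.space (i + 2)) := rfl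
    omega
  have h2 : garnirKer z₀ x₀ i j - orbitKer z₀ x₀ ∈ invKer k V L ν ξ :=
    sub_mem (garnirKer_mem_invKer z₀ x₀ i j) (orbitKer_mem_invKer z₀ x₀)
  have h3 : garnirKer z₀ x₀ i j - orbitKer z₀ x₀ ∈ Submodule.span ℚ
      ({M | ∃ z x, IsSemistandardPair z x ∧ M = orbitKer z x} ∪ raisedProducts ν ξ) := by
    refine Submodule.span_le.mpr ?_ (mem_span_orbitKer h2)
    rintro _ ⟨z, x, hzx, rfl⟩
    have hne : z.dims x ≠ z₀.dims x₀ := by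
      intro h
      apply hzx
      rw [Matrix.sub_apply, apply_eq_of_dims_eq (garnirKer_mem_invKer z₀ x₀ i j) h,
        garnirKer_apply_self, orbitKer_apply, if_pos h, sub_self]
    have hle := dims_le_of_garnirKer_ne_zero z₀ x₀ i j (z := z) (x := x) (by
      rwa [Matrix.sub_apply, orbitKer_apply, if_neg hne, sub_zero] at hzx)
    have hlt := totalDim_lt hle hne
    have := totalDim_le z x
    exact ih _ (by omega) z x rfl
  have := sub_mem h1 h3
  rwa [sub_sub_cancel] at this

/-- Every invariant kernel is a combination of semistandard orbits, modulo kernels factoring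
through flags of a type which is higher in the dominance order. -/
theorem invKer_le_span : invKer k V L ν ξ ≤ Submodule.span ℚ
    ({M | ∃ z x, IsSemistandardPair z x ∧ M = orbitKer z x} ∪ raisedProducts ν ξ) := by
  intro B hB
  refine Submodule.span_le.mpr ?_ (mem_span_orbitKer hB)
  rintro _ ⟨z, x, -, rfl⟩
  exact orbitKer_mem_span z x

end Garnir

end Straightening

/-! ### Products through a fixed type lie in the span of cell elements of more dominant types. -/

section CellSpan

variable {k V : Type*} [Field k] [AddCommGroup V] [Module k V] [Finite k] [Finite V] {L : ℕ}

/-- The dominance relation on arbitrary functions. -/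
def DominatesFn (ω κ : ℕ → ℕ) : Prop :=
  ∀ i, ∑ j ∈ Finset.range i, κ j ≤ ∑ j ∈ Finset.range i, ω j

lemma DominatesFn.trans {α β γ : ℕ → ℕ} (h : DominatesFn α β) (h' : DominatesFn β γ) :
    DominatesFn α γ := fun i => (h' i).trans (h i)

lemma sum_raiseRow (κ : ℕ → ℕ) {i : ℕ} (hi : 0 < κ (i + 1)) (s : ℕ) :
    ∑ j ∈ Finset.range s, raiseRow κ i j =
      ∑ j ∈ Finset.range s, κ j + if s = i + 1 then 1 else 0 := by
  induction s with
  | zero => simp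
  | succ s ih =>
    rw [Finset.sum_range_succ, Finset.sum_range_succ, ih]
    rcases eq_or_ne s (i + 1) with rfl | h
    · simp only [raiseRow, Function.update_self]
      simp
      omega
    rcases eq_or_ne s i with rfl | h'
    · simp [raiseRow]
      omega
    · rw [raiseRow, Function.update_of_ne h, Function.update_of_ne h', if_neg h, if_neg (by omega),
        add_zero, add_zero]

lemma dominatesFn_raiseRow {κ : ℕ → ℕ} {i : ℕ} (hi : 0 < κ (i + 1)) :
    DominatesFn (raiseRow κ i) κ := fun s => by
  rw [sum_raiseRow κ hi]; exact Nat.le_add_right _ _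

variable (k V L) in
/-- The span of the products `(g_Ω)ᵀ g_Ω'` of semistandard orbits in types dominating `κ`. -/
def cellSpan (ξ κ : ℕ → ℕ) : Submodule ℚ (Matrix (PFlag k V L ξ) (PFlag k V L ξ) ℚ) :=
  Submodule.span ℚ {M | ∃ ω, DominatesFn ω κ ∧ ∃ (z z' : PFlag k V L ω) (x x' : PFlag k V L ξ),
    IsSemistandardPair z x ∧ IsSemistandardPair z' x' ∧
      M = (orbitKer z x).transpose * orbitKer z' x'}

omit [Finite k] in
lemma cellSpan_mono {ξ κ κ' : ℕ → ℕ} (h : DominatesFn κ' κ) :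
    cellSpan k V L ξ κ' ≤ cellSpan k V L ξ κ := by
  apply Submodule.span_mono
  rintro _ ⟨ω, h', r⟩
  exact ⟨ω, h'.trans h, r⟩

/-- The sum of the partial sums of `κ`. -/
def domWeight (L : ℕ) (κ : ℕ → ℕ) : ℕ :=
  ∑ s ∈ Finset.range (L + 1), ∑ j ∈ Finset.range s, κ j

omit [Finite k] in
lemma mul_mem_of_isEmpty {ξ κ : ℕ → ℕ} [IsEmpty (PFlag k V L κ)]
    (A : Matrix (PFlag k V L ξ) (PFlag k V L κ) ℚ)
    (B : Matrix (PFlag k V L κ) (PFlag k V L ξ) ℚ)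
    {S : Submodule ℚ (Matrix (PFlag k V L ξ) (PFlag k V L ξ) ℚ)} : A * B ∈ S := by
  have : A * B = 0 := by
    ext a b
    rw [Matrix.mul_apply, Finset.univ_eq_empty, Finset.sum_empty, Matrix.zero_apply]
  rw [this]
  exact zero_mem _

/-- Both factors are straightened towards the middle type `κ`. Semistandard parts give generators
directly; every other term refactors through a raised type, whose sum of partial sums is larger,
while that weight is bounded as soon as flags exist. -/
theorem mul_mem_cellSpan {ξ κ : ℕ → ℕ} {A : Matrix (PFlag k V L ξ) (PFlag k V L κ) ℚ}
    {B : Matrix (PFlag k V L κ) (PFlag k V L ξ) ℚ} (hA : A ∈ invKer k V L ξ κ)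
    (hB : B ∈ invKer k V L κ ξ) : A * B ∈ cellSpan k V L ξ κ := by
  induction hN : (L + 1) * finrank k V - domWeight L κ using Nat.strong_induction_on
    generalizing κ with
  | _ N ih =>
  rcases isEmpty_or_nonempty (PFlag k V L κ) with hempty | ⟨⟨y⟩⟩
  · exact mul_mem_of_isEmpty A B
  have hraise : ∀ {i}, 0 < κ (i + 1) → ∀ {A : Matrix (PFlag k V L ξ) (PFlag k V L (raiseRow κ i)) ℚ}
      {B : Matrix (PFlag k V L (raiseRow κ i)) (PFlag k V L ξ) ℚ},
      A ∈ invKer k V L ξ (raiseRow κ i) → B ∈ invKer k V L (raiseRow κ i) ξ →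
        A * B ∈ cellSpan k V L ξ κ := by
    intro i hi A B hA hB
    rcases isEmpty_or_nonempty (PFlag k V L (raiseRow κ i)) with he | ⟨⟨y'⟩⟩
    · exact mul_mem_of_isEmpty A B
    refine cellSpan_mono (dominatesFn_raiseRow hi) (ih _ ?_ hA hB rfl)
    have hiL : i + 1 < L := by
      by_contra hc
      exact hi.ne' (y.eq_zero_of_le (not_lt.mp hc))
    have h1 : domWeight L κ < domWeight L (raiseRow κ i) := by
      refine Finset.sum_lt_sum (fun s _ => dominatesFn_raiseRow hi s)
        ⟨i + 1, Finset.mem_range.mpr (by omega), ?_⟩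
      rw [sum_raiseRow κ hi, if_pos rfl]
      exact Nat.lt_succ_self _
    have h2 : domWeight L (raiseRow κ i) ≤ (L + 1) * finrank k V := by
      calc _ ≤ ∑ s ∈ Finset.range (L + 1), finrank k V :=
            Finset.sum_le_sum fun s _ => by have := y'.sum_add_finrank s; omega
        _ = _ := by simp
    omega
  have step1 : ∀ z' x', IsSemistandardPair (k := k) (L := L) z' x' →
      A * (orbitKer z' x' : Matrix (PFlag k V L κ) (PFlag k V L ξ) ℚ) ∈ cellSpan k V L ξ κ := by
    intro z' x' hss
    -- Straightening raises the type of the row index, so the left factor is treated through its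
    -- transpose.
    have hAt := invKer_le_span (transpose_mem_invKer hA)
    suffices h : ∀ C : Matrix (PFlag k V L κ) (PFlag k V L ξ) ℚ, C ∈ Submodule.span ℚ
        ({M | ∃ z x, IsSemistandardPair z x ∧ M = orbitKer z x} ∪ raisedProducts κ ξ) →
        C.transpose * (orbitKer z' x' : Matrix (PFlag k V L κ) (PFlag k V L ξ) ℚ) ∈
          cellSpan k V L ξ κ by
      have := h _ hAt
      rwa [Matrix.transpose_transpose] at this
    intro C hC
    induction hC using Submodule.span_induction with
    | mem C hC =>
      rcases hC with ⟨z, x, h, rfl⟩ | ⟨i, hi, I, hI, G, hG, rfl⟩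
      · exact Submodule.subset_span ⟨κ, fun _ => le_rfl, z, z', x, x', h, hss, rfl⟩
      · rw [Matrix.transpose_mul, Matrix.mul_assoc]
        exact hraise hi (transpose_mem_invKer hG)
          (mul_mem_invKer (transpose_mem_invKer hI) (orbitKer_mem_invKer z' x'))
    | zero => rw [Matrix.transpose_zero, Matrix.zero_mul]; exact zero_mem _
    | add C D _ _ h1 h2 => rw [Matrix.transpose_add, Matrix.add_mul]; exact add_mem h1 h2
    | smul c C _ h =>
      rw [Matrix.transpose_smul, Matrix.smul_mul]; exact Submodule.smul_mem _ _ h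
  have hB' := invKer_le_span hB
  clear hB
  induction hB' using Submodule.span_induction with
  | mem C hC =>
    rcases hC with ⟨z, x, h, rfl⟩ | ⟨i, hi, I, hI, G, hG, rfl⟩
    · exact step1 z x h
    · rw [← Matrix.mul_assoc]
      exact hraise hi (mul_mem_invKer hA hI) hG
  | zero => rw [Matrix.mul_zero]; exact zero_mem _
  | add C D _ _ h1 h2 => rw [Matrix.mul_add]; exact add_mem h1 h2
  | smul c C _ h => rw [Matrix.mul_smul]; exact Submodule.smul_mem _ _ h

end CellSpan

/-! ### Growth diagrams for the Robinson–Schensted–Knuth correspondence. -/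

section Growth

/-- The interlacing condition: `q / p` is a horizontal strip. -/
def Interlaces (p q : ℕ → ℕ) : Prop := ∀ i, p i ≤ q i ∧ q (i + 1) ≤ p i

/-- The growth diagram of two chains, computed from the common large end `P 0 = Q 0` downwards. -/
def growth (P Q : ℕ → ℕ → ℕ) : ℕ → ℕ → ℕ → ℕ
  | 0, t, i => P t i
  | s + 1, 0, i => Q (s + 1) i
  -- The piecewise linear local rule. For interlacing neighbours the subtraction is not truncated,
  -- since both terms of the minimum are at least `growth P Q s t (i + 1)`.
  | s + 1, t + 1, i =>
    min (growth P Q s (t + 1) i) (growth P Q (s + 1) t i) +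
      max (growth P Q s (t + 1) (i + 1)) (growth P Q (s + 1) t (i + 1)) - growth P Q s t (i + 1)

/-- The matrix entry attached to a square of the growth diagram. -/
def growthEntry (P Q : ℕ → ℕ → ℕ) (s t : ℕ) : ℕ :=
  growth P Q s t 0 - max (growth P Q s (t + 1) 0) (growth P Q (s + 1) t 0)

/-- A decreasing chain of interlacing functions from `ν` to zero, in `L` steps. -/
structure IsStripChain (L : ℕ) (ν : ℕ → ℕ) (P : ℕ → ℕ → ℕ) : Prop where
  start : P 0 = ν
  last : P L = 0
  interlaces : ∀ t, Interlaces (P (t + 1)) (P t)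

variable {L : ℕ} {ν : ℕ → ℕ} {P Q : ℕ → ℕ → ℕ}

lemma growth_zero_left (t : ℕ) : growth P Q 0 t = P t := by
  funext i; rw [growth]

lemma growth_zero_right (h : P 0 = Q 0) (s : ℕ) : growth P Q s 0 = Q s := by
  cases s with
  | zero => rw [growth_zero_left, h]
  | succ s => funext i; rw [growth]

lemma interlaces_local {α β ν κ : ℕ → ℕ} (hα : Interlaces α ν) (hβ : Interlaces β ν)
    (h : ∀ i, κ i = min (α i) (β i) + max (α (i + 1)) (β (i + 1)) - ν (i + 1)) :
    Interlaces κ α ∧ Interlaces κ β := by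
  constructor <;> intro i
  all_goals
    have := h i
    have := hα i
    have := hα (i + 1)
    have := hβ i
    have := hβ (i + 1)
    omega

lemma growth_interlaces (hP : IsStripChain L ν P) (hQ : IsStripChain L ν Q) (s : ℕ) :
    (∀ t, Interlaces (growth P Q s (t + 1)) (growth P Q s t)) ∧
      ∀ t, Interlaces (growth P Q (s + 1) t) (growth P Q s t) := by
  have h0 : P 0 = Q 0 := hP.start.trans hQ.start.symm
  have step : ∀ s, (∀ t, Interlaces (growth P Q s (t + 1)) (growth P Q s t)) →
      ∀ t, Interlaces (growth P Q (s + 1) t) (growth P Q s t) := by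
    intro s hs t
    induction t with
    | zero => rw [growth_zero_right h0, growth_zero_right h0]; exact hQ.interlaces s
    | succ t ih => exact (interlaces_local (hs t) ih fun i => by rw [growth]).1
  induction s with
  | zero =>
    have : ∀ t, Interlaces (growth P Q 0 (t + 1)) (growth P Q 0 t) := fun t => by
      rw [growth_zero_left, growth_zero_left]; exact hP.interlaces t
    exact ⟨this, step 0 this⟩
  | succ s ih =>
    have : ∀ t, Interlaces (growth P Q (s + 1) (t + 1)) (growth P Q (s + 1) t) := fun t =>
      (interlaces_local (ih.1 t) (ih.2 t) fun i => by rw [growth]).2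
    exact ⟨this, step _ this⟩

lemma growth_le_left (hP : IsStripChain L ν P) (hQ : IsStripChain L ν Q) (s t i : ℕ) :
    growth P Q s t i ≤ P t i := by
  induction s with
  | zero => rw [growth_zero_left]
  | succ s ih => exact ((growth_interlaces hP hQ s).2 t i).1.trans ih

lemma growth_le_right (hP : IsStripChain L ν P) (hQ : IsStripChain L ν Q) (s t i : ℕ) :
    growth P Q s t i ≤ Q s i := by
  induction t with
  | zero => rw [growth_zero_right (hP.start.trans hQ.start.symm)]
  | succ t ih => exact ((growth_interlaces hP hQ s).1 t i).1.trans ih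

lemma IsStripChain.le_start (hP : IsStripChain L ν P) (t i : ℕ) : P t i ≤ ν i := by
  induction t with
  | zero => rw [hP.start]
  | succ t ih => exact (hP.interlaces t i).1.trans ih

/-- The local rule in invertible form: three corners `(s, t + 1)`, `(s + 1, t)`, `(s + 1, t + 1)`
and the entry determine the corner `(s, t)`. -/
lemma growth_local (hP : IsStripChain L ν P) (hQ : IsStripChain L ν Q) (s t : ℕ) :
    (∀ i, growth P Q s t (i + 1) + growth P Q (s + 1) (t + 1) i =
      min (growth P Q s (t + 1) i) (growth P Q (s + 1) t i) +
        max (growth P Q s (t + 1) (i + 1)) (growth P Q (s + 1) t (i + 1))) ∧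
    growth P Q s t 0 = growthEntry P Q s t +
      max (growth P Q s (t + 1) 0) (growth P Q (s + 1) t 0) := by
  have h1 := (growth_interlaces hP hQ s).1 t
  have h2 := (growth_interlaces hP hQ s).2 t
  constructor
  · intro i
    have h3 : growth P Q (s + 1) (t + 1) i =
        min (growth P Q s (t + 1) i) (growth P Q (s + 1) t i) +
          max (growth P Q s (t + 1) (i + 1)) (growth P Q (s + 1) t (i + 1)) -
            growth P Q s t (i + 1) := by rw [growth]
    have := h1 i
    have := h2 i
    omega
  · have := h1 0
    have := h2 0
    unfold growthEntry
    omega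

/-- Summing the local rule over `i` pairs each minimum with the maximum one index later; the entry
supplies the missing maximum at index `0`, and `min + max` is the sum of the two middle shapes. -/
lemma growth_size (hP : IsStripChain L ν P) (hQ : IsStripChain L ν Q) {M : ℕ}
    (hM : ∀ i, M ≤ i → ν i = 0) (s t : ℕ) :
    ∑ i ∈ Finset.range M, growth P Q s t i + ∑ i ∈ Finset.range M, growth P Q (s + 1) (t + 1) i =
      growthEntry P Q s t + ∑ i ∈ Finset.range M, growth P Q s (t + 1) i +
        ∑ i ∈ Finset.range M, growth P Q (s + 1) t i := by
  obtain ⟨h1, h2⟩ := growth_local hP hQ s t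
  have hvan : ∀ s t, growth P Q s t M = 0 := fun s t =>
    Nat.le_zero.mp (((growth_le_left hP hQ s t M).trans (hP.le_start t M)).trans_eq (hM M le_rfl))
  have e : ∀ s t, ∑ i ∈ Finset.range M, growth P Q s t i =
      ∑ i ∈ Finset.range M, growth P Q s t (i + 1) + growth P Q s t 0 := by
    intro s t
    rw [← Finset.sum_range_succ', Finset.sum_range_succ, hvan, add_zero]
  have h3 : ∑ i ∈ Finset.range M, max (growth P Q s (t + 1) i) (growth P Q (s + 1) t i) =
      ∑ i ∈ Finset.range M, max (growth P Q s (t + 1) (i + 1)) (growth P Q (s + 1) t (i + 1)) +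
        max (growth P Q s (t + 1) 0) (growth P Q (s + 1) t 0) := by
    rw [← Finset.sum_range_succ' (fun i => max (growth P Q s (t + 1) i) (growth P Q (s + 1) t i)),
      Finset.sum_range_succ, hvan, hvan, max_self, add_zero]
  have h4 := Finset.sum_congr (rfl : Finset.range M = _) fun i _ => h1 i
  rw [Finset.sum_add_distrib, Finset.sum_add_distrib] at h4
  have h5 : ∑ i ∈ Finset.range M, min (growth P Q s (t + 1) i) (growth P Q (s + 1) t i) +
      ∑ i ∈ Finset.range M, max (growth P Q s (t + 1) i) (growth P Q (s + 1) t i) =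
      ∑ i ∈ Finset.range M, growth P Q s (t + 1) i +
        ∑ i ∈ Finset.range M, growth P Q (s + 1) t i := by
    rw [← Finset.sum_add_distrib, ← Finset.sum_add_distrib]
    exact Finset.sum_congr rfl fun i _ => min_add_max _ _
  have := e s t
  omega

/-- The row sums of the matrix of a growth diagram. -/
lemma sum_growthEntry_right (hP : IsStripChain L ν P) (hQ : IsStripChain L ν Q) {M : ℕ}
    (hM : ∀ i, M ≤ i → ν i = 0) (s : ℕ) :
    ∑ t ∈ Finset.range L, growthEntry P Q s t + ∑ i ∈ Finset.range M, Q (s + 1) i =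
      ∑ i ∈ Finset.range M, Q s i := by
  have h0 : P 0 = Q 0 := hP.start.trans hQ.start.symm
  have key : ∀ T, ∑ t ∈ Finset.range T, growthEntry P Q s t +
      ∑ i ∈ Finset.range M, Q (s + 1) i + ∑ i ∈ Finset.range M, growth P Q s T i =
      ∑ i ∈ Finset.range M, Q s i + ∑ i ∈ Finset.range M, growth P Q (s + 1) T i := by
    intro T
    induction T with
    | zero => simp only [growth_zero_right h0, Finset.range_zero, Finset.sum_empty]; omega
    | succ T ih =>
      have := growth_size hP hQ hM s T
      rw [Finset.sum_range_succ]
      omega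
  have hz : ∀ s, ∑ i ∈ Finset.range M, growth P Q s L i = 0 := fun s =>
    Finset.sum_eq_zero fun i _ => by
      have := growth_le_left hP hQ s L i
      rw [hP.last] at this
      exact Nat.le_zero.mp this
  have := key L
  rw [hz, hz] at this
  exact this

/-- The column sums of the matrix of a growth diagram. -/
lemma sum_growthEntry_left (hP : IsStripChain L ν P) (hQ : IsStripChain L ν Q) {M : ℕ}
    (hM : ∀ i, M ≤ i → ν i = 0) (t : ℕ) :
    ∑ s ∈ Finset.range L, growthEntry P Q s t + ∑ i ∈ Finset.range M, P (t + 1) i =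
      ∑ i ∈ Finset.range M, P t i := by
  have key : ∀ S, ∑ s ∈ Finset.range S, growthEntry P Q s t +
      ∑ i ∈ Finset.range M, P (t + 1) i + ∑ i ∈ Finset.range M, growth P Q S t i =
      ∑ i ∈ Finset.range M, P t i + ∑ i ∈ Finset.range M, growth P Q S (t + 1) i := by
    intro S
    induction S with
    | zero => simp only [growth_zero_left, Finset.range_zero, Finset.sum_empty]; omega
    | succ S ih =>
      have := growth_size hP hQ hM S t
      rw [Finset.sum_range_succ]
      omega
  have hz : ∀ t, ∑ i ∈ Finset.range M, growth P Q L t i = 0 := fun s =>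
    Finset.sum_eq_zero fun i _ => by
      have := growth_le_right hP hQ L s i
      rw [hQ.last] at this
      exact Nat.le_zero.mp this
  have := key L
  rw [hz, hz] at this
  exact this

/-- The matrix of a growth diagram determines both chains. -/
lemma growth_injective {ν' : ℕ → ℕ} {P' Q' : ℕ → ℕ → ℕ}
    (hP : IsStripChain L ν P) (hQ : IsStripChain L ν Q)
    (hP' : IsStripChain L ν' P') (hQ' : IsStripChain L ν' Q')
    (h : ∀ s t, s < L → t < L → growthEntry P Q s t = growthEntry P' Q' s t) :
    ∀ t, t ≤ L → P t = P' t ∧ Q t = Q' t := by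
  -- The boundary rows `s = L` and `t = L` are zero, so `growth_local` reconstructs the diagram from
  -- the entries by descending induction; the edges `s = 0` and `t = 0` are the two chains.
  have key : ∀ N s t, s ≤ L → t ≤ L → (L - s) + (L - t) ≤ N →
      growth P Q s t = growth P' Q' s t := by
    have base : ∀ s t, s ≤ L → t ≤ L → (s = L ∨ t = L) → growth P Q s t = growth P' Q' s t := by
      rintro s t - - (rfl | rfl) <;> funext i
      · have h1 := growth_le_right hP hQ s t i
        have h2 := growth_le_right hP' hQ' s t i
        rw [hQ.last] at h1
        rw [hQ'.last] at h2
        exact (Nat.le_zero.mp h1).trans (Nat.le_zero.mp h2).symm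
      · have h1 := growth_le_left hP hQ s t i
        have h2 := growth_le_left hP' hQ' s t i
        rw [hP.last] at h1
        rw [hP'.last] at h2
        exact (Nat.le_zero.mp h1).trans (Nat.le_zero.mp h2).symm
    intro N
    induction N with
    | zero => exact fun s t hs ht hN => base s t hs ht (by omega)
    | succ N ih =>
      intro s t hs ht hN
      by_cases hst : s = L ∨ t = L
      · exact base s t hs ht hst
      have e1 := ih s (t + 1) hs (by omega) (by omega)
      have e2 := ih (s + 1) t (by omega) ht (by omega)
      have e3 := ih (s + 1) (t + 1) (by omega) (by omega) (by omega)
      obtain ⟨h1, h2⟩ := growth_local hP hQ s t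
      obtain ⟨h1', h2'⟩ := growth_local hP' hQ' s t
      have h3 := h s t (by omega) (by omega)
      rw [e1, e2, e3] at h1
      rw [e1, e2, h3] at h2
      funext i
      cases i with
      | zero => rw [h2, h2']
      | succ i =>
        have := h1 i
        have := h1' i
        omega
  intro t ht
  constructor
  · have := key _ 0 t (Nat.zero_le _) ht le_rfl
    rwa [growth_zero_left, growth_zero_left] at this
  · have := key _ t 0 ht (Nat.zero_le _) le_rfl
    rwa [growth_zero_right (hP.start.trans hQ.start.symm),
      growth_zero_right (hP'.start.trans hQ'.start.symm)] at this

end Growth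

/-! ### Partitions as functions, and semistandard tableaux as inequalities. -/

section Rows

variable {n : ℕ}

lemma row_antitone (μ : n.Partition) : Antitone (row μ) := by
  have hs : (rows μ).Pairwise (· ≥ ·) := Multiset.pairwise_sort μ.parts (· ≥ ·)
  intro i j hij
  rcases eq_or_lt_of_le hij with rfl | hij
  · rfl
  by_cases hj : j < (rows μ).length
  · have hi : i < (rows μ).length := hij.trans hj
    simpa [row, List.getElem?_eq_getElem hi, List.getElem?_eq_getElem hj] using
      List.pairwise_iff_getElem.mp hs i j hi hj hij
  · simp [row, List.getElem?_eq_none (not_lt.mp hj)]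

lemma row_eq_zero (μ : n.Partition) {i : ℕ} (hi : length μ ≤ i) : row μ i = 0 := by
  simp [row, List.getElem?_eq_none (show (rows μ).length ≤ i from hi)]

lemma row_pos (μ : n.Partition) {i : ℕ} (hi : i < length μ) : 0 < row μ i := by
  have hi' : i < (rows μ).length := hi
  have hm : (rows μ)[i] ∈ μ.parts := by
    rw [← Multiset.mem_sort (r := (· ≥ ·))]; exact List.getElem_mem hi'
  simpa [row, List.getElem?_eq_getElem hi'] using μ.parts_pos hm

lemma sum_getD (l : List ℕ) : ∑ i ∈ Finset.range l.length, l.getD i 0 = l.sum := by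
  induction l with
  | nil => simp
  | cons a l ih =>
    rw [List.length_cons, Finset.sum_range_succ', List.sum_cons, ← ih, add_comm]
    simp

lemma sum_row_length (μ : n.Partition) : ∑ i ∈ Finset.range (length μ), row μ i = n := by
  have h1 : (rows μ).sum = n := by
    have h2 : ((rows μ : List ℕ) : Multiset ℕ) = μ.parts := Multiset.sort_eq _ _
    rw [← Multiset.sum_coe, h2, μ.parts_sum]
  exact (sum_getD (rows μ)).trans h1

lemma length_le (μ : n.Partition) : length μ ≤ n := by
  calc length μ = ∑ i ∈ Finset.range (length μ), 1 := by simp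
    _ ≤ ∑ i ∈ Finset.range (length μ), row μ i :=
      Finset.sum_le_sum fun i hi => row_pos μ (Finset.mem_range.mp hi)
    _ = n := sum_row_length μ

lemma sum_row (μ : n.Partition) : ∑ i ∈ Finset.range n, row μ i = n := by
  conv_rhs => rw [← sum_row_length μ]
  symm
  exact Finset.sum_subset (Finset.range_mono (length_le μ)) fun i _ hi =>
    row_eq_zero μ (by simpa using hi)

lemma exists_row_eq {κ : ℕ → ℕ} (h : Antitone κ) (h0 : ∀ i, n ≤ i → κ i = 0)
    (hs : ∑ i ∈ Finset.range n, κ i = n) : ∃ ω : n.Partition, row ω = κ := by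
  have hex : ∃ l, κ l = 0 := ⟨n, h0 n le_rfl⟩
  set l := Nat.find hex with hl
  have hz : ∀ i, l ≤ i → κ i = 0 := fun i hi =>
    Nat.le_zero.mp ((h hi).trans_eq (Nat.find_spec hex))
  have hln : l ≤ n := Nat.find_min' hex (h0 n le_rfl)
  let w : List ℕ := (List.range l).map κ
  have hw : w.sum = n := by
    rw [← hs]
    have : w.sum = ∑ i ∈ Finset.range l, κ i := by
      simp only [w, Finset.sum, Finset.range_val, Multiset.range, Multiset.map_coe,
        Multiset.sum_coe]
    rw [this]
    exact Finset.sum_subset (Finset.range_mono hln) fun i _ hi => hz i (by simpa using hi)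
  have hsort : w.Pairwise (· ≥ ·) := by
    rw [List.pairwise_map]
    exact List.pairwise_lt_range.imp fun hab => h hab.le
  refine ⟨⟨(w : Multiset ℕ), ?_, by rw [Multiset.sum_coe, hw]⟩, ?_⟩
  · intro a ha
    obtain ⟨i, hi, rfl⟩ := List.mem_map.mp (Multiset.mem_coe.mp ha)
    exact Nat.pos_of_ne_zero (Nat.find_min hex (List.mem_range.mp hi))
  · funext i
    have hrows : (Multiset.sort (w : Multiset ℕ) (· ≥ ·)) = w := by
      rw [Multiset.coe_sort]
      exact List.mergeSort_eq_self _ hsort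
    simp only [row, rows, hrows, w]
    by_cases hi : i < l
    · simp [hi]
    · simp [hi, hz i (not_lt.mp hi)]

lemma mem_diagram {μ : n.Partition} {i c : ℕ} : (i, c) ∈ diagram μ ↔ c < row μ i := by
  have h : (i, c) ∈ diagram μ ↔ ∃ h : i < (rows μ).length, c < (rows μ)[i] :=
    YoungDiagram.mem_ofRowLens
  rw [h]
  by_cases hi : i < (rows μ).length
  · simp [hi, row]
  · simp [hi, row]

/-- The combinatorial form of semistandardness of the filling with `a i j` entries `j` in
row `i`. -/
def SemistandardIneq (a : ℕ → ℕ → ℕ) : Prop :=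
  ∀ i j, ∑ t ∈ Finset.range (j + 1), a (i + 1) t ≤ ∑ t ∈ Finset.range j, a i t

/-- Above a cell of row `i + 1` with label at most `j`, column strictness puts a cell of row `i`
with label less than `j`. -/
lemma IsSemistandardMatrix.ineq {ν : n.Partition} {a : ℕ → ℕ → ℕ}
    (h : IsSemistandardMatrix ν a) : SemistandardIneq a := by
  obtain ⟨T, hT⟩ := h
  have key : ∀ i j, ∑ t ∈ Finset.range j, a i t =
      ((Finset.range (row ν i)).filter fun c => T i c < j).card := by
    intro i j
    rw [Finset.card_eq_sum_card_fiberwise (f := fun c => T i c) (t := Finset.range j)]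
    · refine Finset.sum_congr rfl fun t ht => ?_
      rw [← hT, Finset.filter_filter]
      congr 1
      ext c
      have := Finset.mem_range.mp ht
      simp only [Finset.mem_filter]
      constructor
      · rintro ⟨h1, h2⟩; exact ⟨h1, by omega, h2⟩
      · rintro ⟨h1, -, h2⟩; exact ⟨h1, h2⟩
    · intro c hc
      simpa using (Finset.mem_filter.mp hc).2
  intro i j
  rw [key, key]
  apply Finset.card_le_card
  intro c hc
  simp only [Finset.mem_filter, Finset.mem_range] at hc ⊢
  have h1 := T.col_strict (Nat.lt_add_one i) (mem_diagram.mpr hc.1)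
  exact ⟨hc.1.trans_le (row_antitone ν (Nat.le_succ i)), by omega⟩

lemma SemistandardIneq.isSemistandardMatrix {ν : n.Partition} {a : ℕ → ℕ → ℕ}
    (h : SemistandardIneq a) {L : ℕ} (hrow : ∀ i j, L ≤ j → ∑ t ∈ Finset.range j, a i t = row ν i) :
    IsSemistandardMatrix ν a := by
  classical
  set p : ℕ → ℕ → ℕ := fun i j => ∑ t ∈ Finset.range j, a i t with hp
  have hmono : ∀ i, Monotone (p i) := fun i =>
    monotone_nat_of_le_succ fun j => by simp only [hp, Finset.sum_range_succ]; omega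
  have hle : ∀ i j, p i j ≤ row ν i := fun i j => by
    rw [← hrow i (max L j) (le_max_left _ _)]
    exact hmono i (le_max_right _ _)
  have hex : ∀ i c, c < row ν i → ∃ j, c < p i (j + 1) := fun i c hc =>
    ⟨L, by simp only [hp]; rwa [hrow i (L + 1) (Nat.le_succ L)]⟩
  -- The label of cell `c` is the `j` with `p i j ≤ c < p i (j + 1)`, which lists each row in
  -- increasing order; outside the diagram it is `0`, as the tableau structure requires.
  let T : ℕ → ℕ → ℕ := fun i c => if hc : c < row ν i then Nat.find (hex i c hc) else 0
  have hT : ∀ i c j, c < row ν i → (T i c < j ↔ c < p i j) := by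
    intro i c j hc
    simp only [T, dif_pos hc, Nat.find_lt_iff]
    constructor
    · rintro ⟨m, hm, h1⟩
      exact h1.trans_le (hmono i hm)
    · intro h1
      cases j with
      | zero => simp [hp] at h1
      | succ j => exact ⟨j, Nat.lt_succ_self j, h1⟩
  refine ⟨⟨T, ?_, ?_, ?_⟩, ?_⟩
  · intro i c₁ c₂ hc hcell
    have h2 := mem_diagram.mp hcell
    have h3 := (hT i c₂ (T i c₂ + 1) h2).mp (Nat.lt_succ_self _)
    exact Nat.lt_succ_iff.mp ((hT i c₁ _ (hc.trans h2)).mpr (hc.trans h3))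
  · intro i₁ i₂ c hi hcell
    have step : ∀ i, c < row ν (i + 1) → T i c < T (i + 1) c := by
      intro i hc
      have h3 := (hT (i + 1) c (T (i + 1) c + 1) hc).mp (Nat.lt_succ_self _)
      exact (hT i c _ (hc.trans_le (row_antitone ν (Nat.le_succ i)))).mpr (h3.trans_le (h i _))
    have h2 := mem_diagram.mp hcell
    clear hcell
    induction i₂, hi using Nat.le_induction with
    | base => exact step i₁ h2
    | succ m hm ih =>
      exact (ih (h2.trans_le (row_antitone ν (Nat.le_succ m)))).trans (step m h2)
  · intro i c hc
    exact dif_neg fun h' => hc (mem_diagram.mpr h')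
  · intro i j
    have e : ((Finset.range (row ν i)).filter fun c => T i c = j) =
        Finset.range (p i (j + 1)) \ Finset.range (p i j) := by
      ext c
      simp only [Finset.mem_filter, Finset.mem_range, Finset.mem_sdiff]
      constructor
      · rintro ⟨h1, h2⟩
        have h3 := hT i c (j + 1) h1
        have h4 := hT i c j h1
        omega
      · rintro ⟨h1, h2⟩
        have h0 : c < row ν i := h1.trans_le (hle i _)
        have h3 := hT i c (j + 1) h0
        have h4 := hT i c j h0
        omega
    change ((Finset.range (row ν i)).filter fun c => T i c = j).card = a i j
    rw [e, Finset.card_sdiff_of_subset (Finset.range_mono (hmono i (Nat.le_succ j))),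
      Finset.card_range, Finset.card_range]
    simp [hp, Finset.sum_range_succ]

end Rows

/-! ### Semistandard pairs of flags in terms of their intersection matrix. -/

section PairIneq

variable {k V : Type*} [Field k] [AddCommGroup V] [Module k V] [FiniteDimensional k V] {L : ℕ}
  {α β : ℕ → ℕ}

omit [FiniteDimensional k V] in
lemma PFlag.dims_zero_right (z : PFlag k V L α) (x : PFlag k V L β) (i : ℕ) :
    z.dims x i 0 = finrank k (z.space i) := by
  rw [PFlag.dims, interDim, x.space_zero, inf_top_eq]

omit [FiniteDimensional k V] in
lemma PFlag.dims_eq_zero (z : PFlag k V L α) (x : PFlag k V L β) {i j : ℕ} (h : L ≤ i ∨ L ≤ j) :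
    z.dims x i j = 0 := by
  rcases h with h | h
  · rw [PFlag.dims, interDim, z.space_eq_bot h, bot_inf_eq, finrank_bot]
  · rw [PFlag.dims, interDim, x.space_eq_bot h, inf_bot_eq, finrank_bot]

lemma PFlag.sum_mixedDiff (z : PFlag k V L α) (x : PFlag k V L β) (i j : ℕ) :
    (∑ t ∈ Finset.range j, mixedDiff (z.dims x) i t) + z.dims x i j +
      finrank k (z.space (i + 1)) = finrank k (z.space i) + z.dims x (i + 1) j := by
  rw [← z.dims_zero_right x, ← z.dims_zero_right x]
  exact FlagHecke.sum_mixedDiff z.antitone x.antitone i j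

lemma PFlag.row_sum (z : PFlag k V L α) (x : PFlag k V L β) (i : ℕ) {j : ℕ} (hj : L ≤ j) :
    ∑ t ∈ Finset.range j, mixedDiff (z.dims x) i t = α i := by
  have h1 := z.sum_mixedDiff x i j
  rw [z.dims_eq_zero x (Or.inr hj), z.dims_eq_zero x (Or.inr hj)] at h1
  have := z.finrank_eq i
  omega

lemma PFlag.codim_sup (z : PFlag k V L α) (x : PFlag k V L β) (i j : ℕ) :
    finrank k (z.space i) - finrank k ↥(z.space (i + 1) ⊔ (z.space i ⊓ x.space j)) =
      ∑ t ∈ Finset.range j, mixedDiff (z.dims x) i t := by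
  have h1 := Submodule.finrank_sup_add_finrank_inf_eq (z.space (i + 1)) (z.space i ⊓ x.space j)
  rw [← inf_assoc, inf_eq_left.mpr (z.antitone (Nat.le_add_right i 1))] at h1
  have h2 := z.sum_mixedDiff x i j
  have h3 : finrank k ↥(z.space i ⊓ x.space j) = z.dims x i j := rfl
  have h4 : finrank k ↥(z.space (i + 1) ⊓ x.space j) = z.dims x (i + 1) j := rfl
  omega

lemma isSemistandardPair_iff (z : PFlag k V L α) (x : PFlag k V L β) :
    IsSemistandardPair z x ↔ SemistandardIneq (mixedDiff (z.dims x)) := by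
  unfold IsSemistandardPair SemistandardIneq
  refine forall_congr' fun i => forall_congr' fun j => ?_
  rw [z.codim_sup x i j, ← z.codim_sup x (i + 1) (j + 1)]

/-- Raised types need not be partitions, but those carrying a semistandard pair are: the inequality
at `j = L` compares whole rows. -/
lemma IsSemistandardPair.antitone {z : PFlag k V L α} {x : PFlag k V L β}
    (h : IsSemistandardPair z x) : Antitone α := by
  apply antitone_nat_of_succ_le
  intro i
  rw [← z.row_sum x i le_rfl, ← z.row_sum x (i + 1) (Nat.le_succ L)]
  exact (isSemistandardPair_iff z x).mp h i L

/-- Row `i` of a semistandard filling has no label below `i`, so `z i = z (i + 1) + z i ∩ x i`;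
descending induction on `i` then gives the inclusion. -/
lemma IsSemistandardPair.space_le {z : PFlag k V L α} {x : PFlag k V L β}
    (h : IsSemistandardPair z x) (i : ℕ) : z.space i ≤ x.space i := by
  have h' := (isSemistandardPair_iff z x).mp h
  have h0 : ∀ i, ∑ t ∈ Finset.range i, mixedDiff (z.dims x) i t = 0 := by
    intro i
    induction i with
    | zero => simp
    | succ i ih => exact Nat.le_zero.mp ((h' i i).trans_eq ih)
  have h1 : ∀ i, z.space i = z.space (i + 1) ⊔ (z.space i ⊓ x.space i) := by
    intro i
    symm
    have hle : z.space (i + 1) ⊔ (z.space i ⊓ x.space i) ≤ z.space i :=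
      sup_le (z.antitone (Nat.le_succ i)) inf_le_left
    apply Submodule.eq_of_le_of_finrank_eq hle
    have := z.codim_sup x i i
    rw [h0] at this
    have := Submodule.finrank_mono hle
    omega
  have key : ∀ d i, L - i ≤ d → z.space i ≤ x.space i := by
    intro d
    induction d with
    | zero => intro i hi; rw [z.space_eq_bot (by omega)]; exact bot_le
    | succ d ih =>
      intro i hi
      by_cases hL : L ≤ i
      · rw [z.space_eq_bot hL]; exact bot_le
      rw [h1 i]
      exact sup_le ((ih (i + 1) (by omega)).trans (x.antitone (Nat.le_succ i))) inf_le_right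
  exact key _ i le_rfl

end PairIneq

/-! ### Passage between partition flags, orbits and intersection dimensions. -/

section Transport

variable {k : Type*} [Field k] {n : ℕ}

/-- A flag of partition type, viewed as a flag of the type given by the parts. -/
def Flag.toPFlag {μ : n.Partition} (x : Flag k μ) : PFlag k (Fin n → k) n (row μ) where
  space := x.space
  antitone := x.antitone
  space_zero := x.space_zero
  space_last := x.space_eq_bot n (length_le μ)
  finrank_eq := x.finrank_eq

lemma PFlag.space_eq_bot_of_length_le {μ : n.Partition} (x : PFlag k (Fin n → k) n (row μ)) {i : ℕ}
    (hi : length μ ≤ i) : x.space i = ⊥ := by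
  have h1 := x.sum_add_finrank i
  have h2 : ∑ j ∈ Finset.range (length μ), row μ j ≤ ∑ j ∈ Finset.range i, row μ j :=
    Finset.sum_le_sum_of_subset (Finset.range_mono hi)
  rw [sum_row_length] at h2
  rw [Module.finrank_fin_fun] at h1
  exact Submodule.finrank_eq_zero.mp (by omega)

/-- Flags of partition type are the flags of the type given by the parts. -/
def flagEquiv (μ : n.Partition) : Flag k μ ≃ PFlag k (Fin n → k) n (row μ) where
  toFun := Flag.toPFlag
  invFun x :=
    { space := x.space
      antitone := x.antitone
      space_zero := x.space_zero
      space_eq_bot := fun _ hi => x.space_eq_bot_of_length_le hi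
      finrank_eq := x.finrank_eq }
  left_inv _ := rfl
  right_inv _ := rfl

lemma flagEquiv_smul {μ : n.Partition} (g : GL (Fin n) k) (x : Flag k μ) :
    flagEquiv μ (g • x) = glEquiv g • flagEquiv μ x := rfl

lemma glEquiv_surjective : Function.Surjective (glEquiv : GL (Fin n) k → _) := by
  intro e
  refine ⟨Matrix.GeneralLinearGroup.toLin.symm
    (LinearMap.GeneralLinearGroup.ofLinearEquiv e), ?_⟩
  rw [glEquiv, MulEquiv.apply_symm_apply]
  rfl

/-- The intersection dimensions of two flags of partition types. -/
noncomputable def Flag.dims {ν μ : n.Partition} (z : Flag k ν) (x : Flag k μ) : ℕ → ℕ → ℕ :=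
  (flagEquiv ν z).dims (flagEquiv μ x)

lemma orbitMk_eq_iff_dims {ν μ : n.Partition} {z z' : Flag k ν} {x x' : Flag k μ} :
    orbitMk z x = orbitMk z' x' ↔ z.dims x = z'.dims x' := by
  rw [orbitMk_eq_iff, eq_comm (a := z.dims x), Flag.dims, Flag.dims, PFlag.dims_eq_iff]
  constructor
  · rintro ⟨g, rfl, rfl⟩
    exact ⟨glEquiv g, rfl, rfl⟩
  · rintro ⟨e, h1, h2⟩
    obtain ⟨g, rfl⟩ := glEquiv_surjective e
    exact ⟨g, (flagEquiv ν).injective h1, (flagEquiv μ).injective h2⟩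

lemma interMatrix_eq {ν μ : n.Partition} (z : Flag k ν) (x : Flag k μ) :
    interMatrix z x = mixedDiff (z.dims x) := by
  funext i j
  have h1 := Submodule.finrank_quotient_add_finrank
    (((z.space i ⊓ x.space (j + 1)) ⊔ (z.space (i + 1) ⊓ x.space j)).submoduleOf
      (z.space i ⊓ x.space j))
  have h2 := (Submodule.submoduleOfEquivOfLe (sup_inter_le z.antitone x.antitone i j)).finrank_eq
  have h3 := finrank_sup_inter z.antitone x.antitone i j
  have h4 := mixedDiff_add z.antitone x.antitone i j
  have h5 : finrank k ↥(z.space i ⊓ x.space j) = interDim z.space x.space i j := rfl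
  rw [h2] at h1
  change _ = mixedDiff (interDim z.space x.space) i j
  unfold interMatrix
  omega

/-- The embedding condition is implied by semistandardness. For the lengths, `z_i ⊆ x_i` at `i =
length μ` makes `z_i` zero, so the part of `ν` with that index vanishes. -/
lemma permissible_iff {ν μ : n.Partition} (z : Flag k ν) (x : Flag k μ) :
    Permissible z x ↔ IsSemistandardPair (flagEquiv ν z) (flagEquiv μ x) := by
  rw [isSemistandardPair_iff, Permissible, interMatrix_eq]
  constructor
  · exact fun h => h.2.ineq
  · intro h
    have hp := (isSemistandardPair_iff (flagEquiv ν z) (flagEquiv μ x)).mpr h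
    refine ⟨⟨?_, fun i _ _ => hp.space_le i⟩,
      h.isSemistandardMatrix fun i j hj => (flagEquiv ν z).row_sum (flagEquiv μ x) i hj⟩
    by_contra hc
    have h1 : z.space (length μ) = ⊥ :=
      eq_bot_iff.mpr ((hp.space_le (length μ)).trans_eq (x.space_eq_bot _ le_rfl))
    have h2 := z.finrank_eq (length μ)
    have h3 := row_pos ν (not_le.mp hc)
    rw [h1, finrank_bot] at h2
    omega

/-- The intersection dimensions of an orbit. -/
noncomputable def Orbit.dims {ν μ : n.Partition} (Ω : Orbit k ν μ) : ℕ → ℕ → ℕ :=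
  Quotient.liftOn' Ω (fun p => p.1.dims p.2) fun p q h =>
    orbitMk_eq_iff_dims.mp (Quotient.eq''.mpr h : orbitMk p.1 p.2 = orbitMk q.1 q.2)

lemma Orbit.dims_mk {ν μ : n.Partition} (z : Flag k ν) (x : Flag k μ) :
    (orbitMk z x).dims = z.dims x := rfl

lemma Orbit.exists_rep {ν μ : n.Partition} (Ω : Orbit k ν μ) : ∃ z x, orbitMk z x = Ω := by
  induction Ω using Quotient.inductionOn' with
  | h p => exact ⟨p.1, p.2, rfl⟩

lemma Orbit.dims_injective {ν μ : n.Partition} :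
    Function.Injective (Orbit.dims : Orbit k ν μ → _) := by
  intro Ω Ω' h
  obtain ⟨z, x, rfl⟩ := Ω.exists_rep
  obtain ⟨z', x', rfl⟩ := Ω'.exists_rep
  exact orbitMk_eq_iff_dims.mpr h

lemma PermOrbit.ineq {ν μ : n.Partition} (Ω : PermOrbit k ν μ) :
    SemistandardIneq (mixedDiff Ω.1.dims) := by
  obtain ⟨Ω, z, x, rfl, h⟩ := Ω
  exact (isSemistandardPair_iff _ _).mp ((permissible_iff z x).mp h)

lemma Orbit.row_sum {ν μ : n.Partition} (Ω : Orbit k ν μ) (i : ℕ) {j : ℕ} (hj : n ≤ j) :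
    ∑ t ∈ Finset.range j, mixedDiff Ω.dims i t = row ν i := by
  obtain ⟨z, x, rfl⟩ := Ω.exists_rep
  exact (flagEquiv ν z).row_sum (flagEquiv μ x) i hj

lemma Orbit.col_sum {ν μ : n.Partition} (Ω : Orbit k ν μ) {i : ℕ} (hi : n ≤ i) (j : ℕ) :
    ∑ t ∈ Finset.range i, mixedDiff Ω.dims t j = row μ j := by
  obtain ⟨z, x, rfl⟩ := Ω.exists_rep
  rw [← (flagEquiv μ x).row_sum (flagEquiv ν z) j hi]
  have h : ∀ a b, (flagEquiv ν z).dims (flagEquiv μ x) a b =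
      (flagEquiv μ x).dims (flagEquiv ν z) b a := fun a b => by
    unfold PFlag.dims interDim
    rw [inf_comm]
  refine Finset.sum_congr rfl fun t _ => ?_
  rw [Orbit.dims_mk, Flag.dims]
  simp only [mixedDiff, h]
  omega

lemma Orbit.mixedDiff_add {ν μ : n.Partition} (Ω : Orbit k ν μ) (i j : ℕ) :
    mixedDiff Ω.dims i j + Ω.dims i (j + 1) + Ω.dims (i + 1) j =
      Ω.dims i j + Ω.dims (i + 1) (j + 1) := by
  obtain ⟨z, x, rfl⟩ := Ω.exists_rep
  exact FlagHecke.mixedDiff_add z.antitone x.antitone i j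

lemma Orbit.dims_eq_zero {ν μ : n.Partition} (Ω : Orbit k ν μ) {i j : ℕ} (h : n ≤ i ∨ n ≤ j) :
    Ω.dims i j = 0 := by
  obtain ⟨z, x, rfl⟩ := Ω.exists_rep
  exact PFlag.dims_eq_zero _ _ h

lemma Orbit.eq_of_mixedDiff_eq {ν μ : n.Partition} {Ω Ω' : Orbit k ν μ}
    (h : ∀ i j, j < n → mixedDiff Ω.dims i j = mixedDiff Ω'.dims i j) : Ω = Ω' := by
  apply Orbit.dims_injective
  have key : ∀ N i j, (n - i) + (n - j) ≤ N → Ω.dims i j = Ω'.dims i j := by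
    intro N
    induction N with
    | zero =>
      intro i j hN
      rw [Ω.dims_eq_zero (by omega), Ω'.dims_eq_zero (by omega)]
    | succ N ih =>
      intro i j hN
      by_cases hij : n ≤ i ∨ n ≤ j
      · rw [Ω.dims_eq_zero hij, Ω'.dims_eq_zero hij]
      have h1 := Ω.mixedDiff_add i j
      have h2 := Ω'.mixedDiff_add i j
      rw [h i j (by omega), ih i (j + 1) (by omega), ih (i + 1) j (by omega),
        ih (i + 1) (j + 1) (by omega)] at h1
      omega
  funext i j
  exact key _ i j le_rfl

end Transport

/-! ### Realizing an integer matrix by coordinate flags. -/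

section Realization

variable (k : Type*) [Field k] {n : ℕ}

/-- The coordinate subspace of a set of indices. -/
def coordSpace (S : Finset (Fin n)) : Submodule k (Fin n → k) :=
  ⨅ t ∈ ((S : Set (Fin n))ᶜ), LinearMap.ker (LinearMap.proj t : (Fin n → k) →ₗ[k] k)

lemma mem_coordSpace {S : Finset (Fin n)} {v : Fin n → k} :
    v ∈ coordSpace k S ↔ ∀ t, t ∉ S → v t = 0 := by
  simp [coordSpace]

lemma finrank_coordSpace (S : Finset (Fin n)) : finrank k (coordSpace k S) = S.card := by
  have e : coordSpace k S ≃ₗ[k] (↥(S : Set (Fin n)) → k) :=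
    LinearMap.iInfKerProjEquiv k (fun _ : Fin n => k) disjoint_compl_right
      (by simp)
  rw [e.finrank_eq, Module.finrank_fintype_fun_eq_card]
  simp

lemma coordSpace_inf (S T : Finset (Fin n)) :
    coordSpace k S ⊓ coordSpace k T = coordSpace k (S ∩ T) := by
  ext v
  simp only [Submodule.mem_inf, mem_coordSpace, Finset.mem_inter]
  constructor
  · rintro ⟨h1, h2⟩ t ht
    by_cases h : t ∈ S
    · exact h2 t fun h' => ht ⟨h, h'⟩
    · exact h1 t h
  · exact fun h => ⟨fun t ht => h t fun h' => ht h'.1, fun t ht => h t fun h' => ht h'.2⟩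

/-- The coordinate flag of a labelling of the coordinates. -/
def coordFlag {κ : ℕ → ℕ} (r : Fin n → ℕ) (hr : ∀ t, r t < n)
    (h : ∀ i, (Finset.univ.filter fun t => r t = i).card = κ i) : PFlag k (Fin n → k) n κ where
  space i := coordSpace k (Finset.univ.filter fun t => i ≤ r t)
  antitone i j hij v hv := by
    rw [mem_coordSpace] at hv ⊢
    intro t ht
    apply hv
    simp only [Finset.mem_filter, Finset.mem_univ, true_and] at ht ⊢
    omega
  space_zero := by
    ext v
    simp [mem_coordSpace]
  space_last := by
    rw [eq_bot_iff]
    intro v hv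
    rw [mem_coordSpace] at hv
    rw [Submodule.mem_bot]
    funext t
    exact hv t (by simp [hr t])
  finrank_eq i := by
    rw [finrank_coordSpace, finrank_coordSpace, ← h i, ← Finset.card_union_of_disjoint]
    · congr 1
      ext t
      simp only [Finset.mem_filter, Finset.mem_univ, true_and, Finset.mem_union]
      omega
    · rw [Finset.disjoint_filter]
      intro t _ h1 h2
      omega

lemma mixedDiff_coordFlag {α β : ℕ → ℕ} (r c : Fin n → ℕ) (hr : ∀ t, r t < n)
    (hc : ∀ t, c t < n)
    (hα : ∀ i, (Finset.univ.filter fun t => r t = i).card = α i)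
    (hβ : ∀ j, (Finset.univ.filter fun t => c t = j).card = β j) (i j : ℕ) :
    mixedDiff ((coordFlag k r hr hα).dims (coordFlag k c hc hβ)) i j =
      (Finset.univ.filter fun t => r t = i ∧ c t = j).card := by
  have hd : ∀ i j, (coordFlag k r hr hα).dims (coordFlag k c hc hβ) i j =
      ∑ t, if i ≤ r t ∧ j ≤ c t then 1 else 0 := by
    intro i j
    have e : (coordFlag k r hr hα).space i ⊓ (coordFlag k c hc hβ).space j = coordSpace k _ :=
      coordSpace_inf k _ _
    rw [PFlag.dims, interDim, e, finrank_coordSpace, ← Finset.filter_and, Finset.card_filter]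
  have h : ∑ t, (if i ≤ r t ∧ j ≤ c t then 1 else 0) +
      ∑ t, (if i + 1 ≤ r t ∧ j + 1 ≤ c t then 1 else 0) =
      ∑ t, (if r t = i ∧ c t = j then 1 else 0) +
      (∑ t, (if i ≤ r t ∧ j + 1 ≤ c t then 1 else 0) +
      ∑ t, (if i + 1 ≤ r t ∧ j ≤ c t then 1 else 0)) := by
    rw [← Finset.sum_add_distrib, ← Finset.sum_add_distrib, ← Finset.sum_add_distrib]
    refine Finset.sum_congr rfl fun t _ => ?_
    split_ifs <;> omega
  rw [mixedDiff, hd, hd, hd, hd, Finset.card_filter]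
  omega

/-- Every matrix with the right row and column sums is the intersection matrix of an orbit. -/
lemma exists_orbit_of_matrix {ν μ : n.Partition} (m : ℕ → ℕ → ℕ)
    (h0 : ∀ i j, n ≤ i ∨ n ≤ j → m i j = 0)
    (hrow : ∀ i, i < n → ∑ j ∈ Finset.range n, m i j = row ν i)
    (hcol : ∀ j, j < n → ∑ i ∈ Finset.range n, m i j = row μ j) :
    ∃ Ω : Orbit k ν μ, ∀ i j, mixedDiff Ω.dims i j = m i j := by
  have hcard : Fintype.card (Σ p : Fin n × Fin n, Fin (m p.1 p.2)) = Fintype.card (Fin n) := by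
    simp only [Fintype.card_sigma, Fintype.card_fin, Fintype.sum_prod_type]
    calc ∑ i : Fin n, ∑ j : Fin n, m i j = ∑ i : Fin n, row ν i :=
          Finset.sum_congr rfl fun i _ => by rw [← hrow i i.2, Finset.sum_range]
      _ = n := by rw [← Finset.sum_range (fun i => row ν i), sum_row]
  -- The `n` coordinates are distributed over the cells of the matrix, `m i j` of them in cell `(i,
  -- j)`; the row and column labels then define the two flags.
  let e : Fin n ≃ (Σ p : Fin n × Fin n, Fin (m p.1 p.2)) := (Fintype.equivOfCardEq hcard).symm
  let r : Fin n → ℕ := fun t => (e t).1.1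
  let c : Fin n → ℕ := fun t => (e t).1.2
  have hcount : ∀ f : ℕ → ℕ → Prop, ∀ [DecidableRel f],
      (Finset.univ.filter fun t => f (r t) (c t)).card =
        ∑ i ∈ Finset.range n, ∑ j ∈ Finset.range n, if f i j then m i j else 0 := by
    intro f _
    rw [Finset.card_filter]
    rw [Equiv.sum_comp e (fun s => if f s.1.1 s.1.2 then 1 else 0), Fintype.sum_sigma,
      Fintype.sum_prod_type, Finset.sum_range]
    refine Finset.sum_congr rfl fun i _ => ?_
    rw [Finset.sum_range]
    refine Finset.sum_congr rfl fun j _ => ?_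
    split_ifs <;> simp
  have hα : ∀ i, (Finset.univ.filter fun t => r t = i).card = row ν i := by
    intro i
    rw [hcount (fun a _ => a = i)]
    by_cases hi : i < n
    · rw [Finset.sum_eq_single i]
      · simp [hrow i hi]
      · intro a _ ha; simp [ha]
      · intro h; exact absurd (Finset.mem_range.mpr hi) h
    · rw [row_eq_zero ν ((length_le ν).trans (not_lt.mp hi))]
      refine Finset.sum_eq_zero fun a ha => Finset.sum_eq_zero fun b _ => if_neg ?_
      have := Finset.mem_range.mp ha
      omega
  have hβ : ∀ j, (Finset.univ.filter fun t => c t = j).card = row μ j := by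
    intro j
    rw [hcount (fun _ b => b = j), Finset.sum_comm]
    by_cases hj : j < n
    · rw [Finset.sum_eq_single j]
      · simp [hcol j hj]
      · intro a _ ha; simp [ha]
      · intro h; exact absurd (Finset.mem_range.mpr hj) h
    · rw [row_eq_zero μ ((length_le μ).trans (not_lt.mp hj))]
      refine Finset.sum_eq_zero fun a ha => Finset.sum_eq_zero fun b _ => if_neg ?_
      have := Finset.mem_range.mp ha
      omega
  refine ⟨orbitMk ((flagEquiv ν).symm (coordFlag k r (fun t => (e t).1.1.2) hα))
    ((flagEquiv μ).symm (coordFlag k c (fun t => (e t).1.2.2) hβ)), fun i j => ?_⟩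
  rw [Orbit.dims_mk, Flag.dims, Equiv.apply_symm_apply, Equiv.apply_symm_apply,
    mixedDiff_coordFlag, hcount (fun a b => a = i ∧ b = j)]
  by_cases hij : i < n ∧ j < n
  · rw [Finset.sum_eq_single i, Finset.sum_eq_single j]
    · simp
    · intro b _ hb; simp [hb]
    · intro h; exact absurd (Finset.mem_range.mpr hij.2) h
    · intro a _ ha; simp [ha]
    · intro h; exact absurd (Finset.mem_range.mpr hij.1) h
  · rw [h0 i j (by omega)]
    refine Finset.sum_eq_zero fun a ha => Finset.sum_eq_zero fun b hb => if_neg ?_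
    have := Finset.mem_range.mp ha
    have := Finset.mem_range.mp hb
    omega

end Realization

/-! ### Bounding the number of cell elements by the number of orbits. -/

section Count

variable {k : Type*} [Field k] {n : ℕ} {ν μ : n.Partition}

/-- The chain of shapes of the tableau of an orbit, from the whole shape down to zero. -/
noncomputable def Orbit.chain (Ω : Orbit k ν μ) (t i : ℕ) : ℕ :=
  ∑ j ∈ Finset.range (n - t), mixedDiff Ω.dims i j

lemma PermOrbit.isStripChain (Ω : PermOrbit k ν μ) : IsStripChain n (row ν) Ω.1.chain where
  start := funext fun i => Ω.1.row_sum i le_rfl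
  last := funext fun i => by simp [Orbit.chain]
  interlaces t i := by
    by_cases ht : t < n
    · have e : n - t = n - (t + 1) + 1 := by omega
      refine ⟨Finset.sum_le_sum_of_subset (Finset.range_mono (by omega)), ?_⟩
      have := Ω.ineq i (n - (t + 1))
      rwa [← e] at this
    · have h1 : n - t = 0 := by omega
      have h2 : n - (t + 1) = 0 := by omega
      simp [Orbit.chain, h1, h2]

lemma Orbit.sum_chain (Ω : Orbit k ν μ) (t : ℕ) :
    ∑ i ∈ Finset.range n, Ω.chain t i = ∑ j ∈ Finset.range (n - t), row μ j := by
  simp only [Orbit.chain]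
  rw [Finset.sum_comm]
  exact Finset.sum_congr rfl fun j _ => Ω.col_sum le_rfl j

lemma Orbit.eq_of_chain_eq {Ω Ω' : Orbit k ν μ} (h : ∀ t, t ≤ n → Ω.chain t = Ω'.chain t) :
    Ω = Ω' := by
  apply Orbit.eq_of_mixedDiff_eq
  intro i j hj
  have h1 := congrFun (h (n - j) (Nat.sub_le _ _)) i
  have h2 := congrFun (h (n - (j + 1)) (Nat.sub_le _ _)) i
  simp only [Orbit.chain] at h1 h2
  rw [show n - (n - j) = j by omega] at h1
  rw [show n - (n - (j + 1)) = j + 1 by omega, Finset.sum_range_succ, Finset.sum_range_succ] at h2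
  omega

/-- The Robinson–Schensted–Knuth correspondence: a pair of semistandard orbits of the same shape
is encoded in a matrix. -/
lemma exists_orbit_growth (Ω₁ Ω₂ : PermOrbit k ν μ) :
    ∃ Ω : Orbit k μ μ, ∀ s t, s < n → t < n →
      mixedDiff Ω.dims (n - 1 - s) (n - 1 - t) = growthEntry Ω₁.1.chain Ω₂.1.chain s t := by
  have h1 := Ω₁.isStripChain
  have h2 := Ω₂.isStripChain
  have hM : ∀ i, n ≤ i → row ν i = 0 := fun i hi => row_eq_zero ν ((length_le ν).trans hi)
  have hsum : ∀ (Ω : Orbit k ν μ) s, s < n → ∑ i ∈ Finset.range n, Ω.chain s i =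
      ∑ i ∈ Finset.range n, Ω.chain (s + 1) i + row μ (n - 1 - s) := by
    intro Ω s hs
    rw [Orbit.sum_chain, Orbit.sum_chain, show n - s = n - (s + 1) + 1 by omega,
      Finset.sum_range_succ, show n - (s + 1) = n - 1 - s by omega]
  -- Chains run downwards from the full shape, so step `s` removes the label `n - 1 - s`; the
  -- entries are reversed in both directions to match the parts of `μ`.
  obtain ⟨Ω, hΩ⟩ := exists_orbit_of_matrix k (ν := μ) (μ := μ)
    (fun i j => if i < n ∧ j < n then
      growthEntry Ω₁.1.chain Ω₂.1.chain (n - 1 - i) (n - 1 - j) else 0)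
    (fun i j h => if_neg (by omega))
    (by
      intro i hi
      have e1 := sum_growthEntry_right h1 h2 hM (n - 1 - i)
      have e2 := hsum Ω₂.1 (n - 1 - i) (by omega)
      rw [show n - 1 - (n - 1 - i) = i by omega] at e2
      rw [← Finset.sum_range_reflect] at e1
      have e3 : ∑ j ∈ Finset.range n, (if i < n ∧ j < n then
          growthEntry Ω₁.1.chain Ω₂.1.chain (n - 1 - i) (n - 1 - j) else 0) =
          ∑ j ∈ Finset.range n, growthEntry Ω₁.1.chain Ω₂.1.chain (n - 1 - i) (n - 1 - j) :=
        Finset.sum_congr rfl fun j hj => if_pos ⟨hi, Finset.mem_range.mp hj⟩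
      rw [e3]
      omega)
    (by
      intro j hj
      have e1 := sum_growthEntry_left h1 h2 hM (n - 1 - j)
      have e2 := hsum Ω₁.1 (n - 1 - j) (by omega)
      rw [show n - 1 - (n - 1 - j) = j by omega] at e2
      rw [← Finset.sum_range_reflect] at e1
      have e3 : ∑ i ∈ Finset.range n, (if i < n ∧ j < n then
          growthEntry Ω₁.1.chain Ω₂.1.chain (n - 1 - i) (n - 1 - j) else 0) =
          ∑ i ∈ Finset.range n, growthEntry Ω₁.1.chain Ω₂.1.chain (n - 1 - i) (n - 1 - j) :=
        Finset.sum_congr rfl fun i hi => if_pos ⟨Finset.mem_range.mp hi, hj⟩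
      rw [e3]
      omega)
  refine ⟨Ω, fun s t hs ht => ?_⟩
  rw [hΩ, if_pos (by omega), show n - 1 - (n - 1 - s) = s by omega,
    show n - 1 - (n - 1 - t) = t by omega]

lemma card_permOrbit_pairs_le [Finite k] (μ : n.Partition) :
    Nat.card (Σ ν : Below μ, PermOrbit k ν.1 μ × PermOrbit k ν.1 μ) ≤ Nat.card (Orbit k μ μ) := by
  choose f hf using fun p : Σ ν : Below μ, PermOrbit k ν.1 μ × PermOrbit k ν.1 μ =>
    exists_orbit_growth p.2.1 p.2.2
  refine Nat.card_le_card_of_injective f ?_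
  rintro ⟨ν, Ω₁, Ω₂⟩ ⟨ν', Ω₁', Ω₂'⟩ h
  have h1 := hf ⟨ν, Ω₁, Ω₂⟩
  have h2 := hf ⟨ν', Ω₁', Ω₂'⟩
  rw [h] at h1
  have h3 := growth_injective Ω₁.isStripChain Ω₂.isStripChain Ω₁'.isStripChain Ω₂'.isStripChain
    fun s t hs ht => (h1 s t hs ht).symm.trans (h2 s t hs ht)
  have h4 : ν = ν' := by
    apply Subtype.ext
    apply row_injective
    rw [← Ω₁.isStripChain.start, ← Ω₁'.isStripChain.start]
    exact (h3 0 (Nat.zero_le _)).1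
  subst h4
  have h5 : Ω₁ = Ω₁' := Subtype.ext (Orbit.eq_of_chain_eq fun t ht => (h3 t ht).1)
  have h6 : Ω₂ = Ω₂' := Subtype.ext (Orbit.eq_of_chain_eq fun t ht => (h3 t ht).2)
  rw [h5, h6]

end Count

/-! ### Hecke modules as spaces of invariant kernels. -/

section Kernel

variable {k : Type*} [Field k] [Finite k] {n : ℕ} {ν μ κ : n.Partition}

open Classical in
/-- The matrix of a map between function spaces on flags. -/
noncomputable def kernel : HeckeModule k ν μ →ₗ[ℚ]
    Matrix (PFlag k (Fin n → k) n (row ν)) (PFlag k (Fin n → k) n (row μ)) ℚ where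
  toFun a := Matrix.reindex (flagEquiv ν) (flagEquiv μ) (LinearMap.toMatrix' a.toLinearMap)
  map_add' _ _ := rfl
  map_smul' _ _ := rfl

open Classical in
lemma kernel_apply (a : HeckeModule k ν μ) (z : Flag k ν) (x : Flag k μ) :
    kernel a (flagEquiv ν z) (flagEquiv μ x) = a (Pi.single x 1) z := by
  simp [kernel, LinearMap.toMatrix'_apply]

lemma kernel_injective : Function.Injective (kernel : HeckeModule k ν μ →ₗ[ℚ] _) := by
  classical
  intro a b h
  apply Representation.IntertwiningMap.toLinearMap_injective
  exact LinearMap.toMatrix'.injective ((Matrix.reindex _ _).injective h)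

lemma kernel_comp (a : HeckeModule k ν μ) (b : HeckeModule k μ κ) :
    kernel (a.comp b : HeckeModule k ν κ) = kernel a * kernel b := by
  classical
  change Matrix.reindex _ _ (LinearMap.toMatrix' (a.toLinearMap.comp b.toLinearMap)) = _
  rw [LinearMap.toMatrix'_comp]
  exact (Matrix.submatrix_mul_equiv _ _ _ (flagEquiv μ).symm _).symm

lemma kernel_mem_invKer (a : HeckeModule k ν μ) :
    kernel a ∈ invKer k (Fin n → k) n (row ν) (row μ) := by
  classical
  intro e z x
  obtain ⟨g, rfl⟩ := glEquiv_surjective e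
  obtain ⟨z, rfl⟩ := (flagEquiv ν).surjective z
  obtain ⟨x, rfl⟩ := (flagEquiv μ).surjective x
  rw [← flagEquiv_smul, ← flagEquiv_smul, kernel_apply, kernel_apply]
  have h1 : (Pi.single (g • x) 1 : Flag k μ → ℚ) = flagRep k μ g (Pi.single x 1) := by
    funext y
    rw [flagRep_apply, Pi.single_apply, Pi.single_apply]
    exact if_congr inv_smul_eq_iff.symm rfl rfl
  have h2 : a (flagRep k μ g (Pi.single x 1)) = flagRep k ν g (a (Pi.single x 1)) :=
    LinearMap.congr_fun (a.isIntertwining' g) _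
  rw [h1, h2, flagRep_apply, inv_smul_smul]

lemma exists_kernel_eq
    {B : Matrix (PFlag k (Fin n → k) n (row ν)) (PFlag k (Fin n → k) n (row μ)) ℚ}
    (hB : B ∈ invKer k (Fin n → k) n (row ν) (row μ)) : ∃ a : HeckeModule k ν μ, kernel a = B := by
  classical
  refine ⟨⟨Matrix.toLin' ((Matrix.reindex (flagEquiv ν) (flagEquiv μ)).symm B), ?_⟩, ?_⟩
  · intro g
    refine LinearMap.ext fun f => ?_
    funext z
    rw [LinearMap.comp_apply, LinearMap.comp_apply, flagRep_apply, Matrix.toLin'_apply,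
      Matrix.toLin'_apply, Matrix.mulVec, Matrix.mulVec, dotProduct, dotProduct]
    refine (Fintype.sum_equiv (MulAction.toPerm g) _ _ fun x => ?_).symm
    rw [MulAction.toPerm_apply, flagRep_apply, inv_smul_smul]
    congr 1
    have := hB (glEquiv g) (flagEquiv ν (g⁻¹ • z)) (flagEquiv μ x)
    rw [← flagEquiv_smul, ← flagEquiv_smul, smul_inv_smul] at this
    exact this.symm
  · change Matrix.reindex _ _ (LinearMap.toMatrix' (Matrix.toLin' _)) = _
    rw [LinearMap.toMatrix'_toLin', Equiv.apply_symm_apply]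

open Classical in
lemma kernel_geom_apply (Ω : Orbit k ν μ) (z : Flag k ν) (x : Flag k μ) :
    kernel (geom Ω) (flagEquiv ν z) (flagEquiv μ x) = if orbitMk z x = Ω then 1 else 0 := by
  rw [kernel_apply]
  change ∑ y : Flag k μ with orbitMk z y = Ω, (Pi.single x 1 : Flag k μ → ℚ) y = _
  rw [Finset.sum_filter, Finset.sum_eq_single x]
  · simp
  · intro y _ hy
    simp [hy]
  · intro h
    exact absurd (Finset.mem_univ x) h

lemma kernel_geom_mk (z : Flag k ν) (x : Flag k μ) :
    kernel (geom (orbitMk z x)) = orbitKer (flagEquiv ν z) (flagEquiv μ x) := by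
  classical
  ext z' x'
  obtain ⟨z', rfl⟩ := (flagEquiv ν).surjective z'
  obtain ⟨x', rfl⟩ := (flagEquiv μ).surjective x'
  rw [kernel_geom_apply, orbitKer_apply]
  exact if_congr orbitMk_eq_iff_dims rfl rfl

lemma kernel_geom_op (Ω : Orbit k ν μ) : kernel (geom Ω.op) = (kernel (geom Ω)).transpose := by
  classical
  ext x' z'
  obtain ⟨z', rfl⟩ := (flagEquiv ν).surjective z'
  obtain ⟨x', rfl⟩ := (flagEquiv μ).surjective x'
  obtain ⟨z, x, rfl⟩ := Ω.exists_rep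
  rw [Matrix.transpose_apply, Orbit.op_mk, kernel_geom_apply, kernel_geom_apply]
  refine if_congr ?_ rfl rfl
  rw [orbitMk_eq_iff, orbitMk_eq_iff]
  exact exists_congr fun g => and_comm

lemma kernel_cellElt (ω : Below μ) (Ω₁ Ω₂ : PermOrbit k ω.1 μ) :
    kernel (cellElt μ ω Ω₁ Ω₂) = (kernel (geom Ω₁.1)).transpose * kernel (geom Ω₂.1) := by
  rw [← kernel_geom_op]
  exact kernel_comp _ _

/-- The orbit of a semistandard pair is permissible. -/
lemma IsSemistandardPair.exists_permOrbit {z : PFlag k (Fin n → k) n (row ν)}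
    {x : PFlag k (Fin n → k) n (row μ)} (h : IsSemistandardPair z x) :
    ∃ Ω : PermOrbit k ν μ, kernel (geom Ω.1) = orbitKer z x := by
  obtain ⟨z, rfl⟩ := (flagEquiv ν).surjective z
  obtain ⟨x, rfl⟩ := (flagEquiv μ).surjective x
  exact ⟨⟨orbitMk z x, z, x, rfl, (permissible_iff z x).mpr h⟩, kernel_geom_mk z x⟩

/-- `cellSpan` allows arbitrary types `ω`, but a semistandard pair forces `ω` to be antitone, hence
the row function of a partition, and its orbits are then permissible. -/
lemma cellSpan_le_map_kernel {κ : ℕ → ℕ} (hκ : DominatesFn κ (row μ)) :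
    cellSpan k (Fin n → k) n (row μ) κ ≤ (Submodule.span ℚ {a : HeckeModule k μ μ |
      ∃ ω : Below μ, DominatesFn (row ω.1) κ ∧ ∃ u v : PermOrbit k ω.1 μ,
        a = cellElt μ ω u v}).map kernel := by
  refine Submodule.span_le.mpr ?_
  rintro _ ⟨ω, hω, z, z', x, x', h, h', rfl⟩
  obtain ⟨ω, rfl⟩ : ∃ ω' : n.Partition, row ω' = ω :=
    exists_row_eq h.antitone (fun i hi => z.eq_zero_of_le hi)
      (z.sum_eq.trans (Module.finrank_fin_fun k))
  obtain ⟨u, hu⟩ := h.exists_permOrbit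
  obtain ⟨v, hv⟩ := h'.exists_permOrbit
  let ω' : Below μ := ⟨ω, hω.trans hκ⟩
  refine ⟨cellElt μ ω' u v, Submodule.subset_span ⟨ω', hω, u, v, rfl⟩, ?_⟩
  rw [kernel_cellElt, hu, hv]

/-- Raising increases the sum of the first `i + 1` parts by one, so the dominance is strict. -/
lemma lt_of_dominatesFn_raiseRow {τ ω : Below μ} {i : ℕ} (hi : 0 < row τ.1 (i + 1))
    (h : DominatesFn (row ω.1) (raiseRow (row τ.1) i)) : τ < ω := by
  refine lt_iff_le_not_ge.mpr ⟨fun s => (dominatesFn_raiseRow hi s).trans (h s), fun h' => ?_⟩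
  have h1 := h (i + 1)
  have h2 := h' (i + 1)
  rw [sum_raiseRow _ hi, if_pos rfl] at h1
  omega

end Kernel

/-! ### The cellular basis. -/

section Main

variable {k : Type*} [Field k] [Finite k] {n : ℕ} (μ : n.Partition)

/-- Every `a` is `a ∘ 1`, a product factoring through flags of type `μ` itself, so
`mul_mem_cellSpan` applies. -/
lemma span_cellElt : Submodule.span ℚ (Set.range
    fun p : Σ ω : Below μ, PermOrbit k ω.1 μ × PermOrbit k ω.1 μ =>
      cellElt μ p.1 p.2.1 p.2.2) = ⊤ := by
  rw [eq_top_iff]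
  intro a _
  have h := mul_mem_cellSpan (kernel_mem_invKer a) (kernel_mem_invKer (1 : HeckeAlgebra k μ))
  rw [← kernel_comp] at h
  obtain ⟨b, hb, hba⟩ := cellSpan_le_map_kernel (fun _ => le_rfl) h
  have e : b = a := kernel_injective hba
  subst e
  refine Submodule.span_mono ?_ hb
  rintro _ ⟨ω, -, u, v, rfl⟩
  exact ⟨⟨ω, u, v⟩, rfl⟩

lemma linearIndependent_geom :
    LinearIndependent ℚ (fun Ω : Orbit k μ μ => (geom Ω : HeckeAlgebra k μ)) := by
  classical
  have := Fintype.ofFinite (Orbit k μ μ)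
  rw [Fintype.linearIndependent_iff]
  intro c hc Ω
  obtain ⟨z, x, rfl⟩ := Ω.exists_rep
  have h := congrArg (fun a => kernel a (flagEquiv μ z) (flagEquiv μ x)) hc
  simp only [map_sum, map_smul, Matrix.sum_apply, Matrix.smul_apply, kernel_geom_apply] at h
  simpa using h

/-- The number of cell elements is at most the number of orbits, which is at most the dimension
because orbit indicators are independent; a spanning family of that size is a basis. -/
lemma linearIndependent_cellElt : LinearIndependent ℚ
    (fun p : Σ ω : Below μ, PermOrbit k ω.1 μ × PermOrbit k ω.1 μ =>
      (cellElt μ p.1 p.2.1 p.2.2 : HeckeAlgebra k μ)) := by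
  have := Fintype.ofFinite (Orbit k μ μ)
  have := Fintype.ofFinite (Below μ)
  have hfin : Module.Finite ℚ (HeckeAlgebra k μ) :=
    ⟨Submodule.fg_def.mpr ⟨_, Set.finite_range _, span_cellElt μ⟩⟩
  apply linearIndependent_of_top_le_span_of_card_eq_finrank (span_cellElt μ).ge
  apply le_antisymm
  · have h1 := card_permOrbit_pairs_le (k := k) μ
    rw [Nat.card_eq_fintype_card, Nat.card_eq_fintype_card] at h1
    exact h1.trans (linearIndependent_geom μ).fintype_card_le_finrank
  · exact finrank_le_of_span_eq_top (span_cellElt μ)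

lemma exists_star_cellElt : ∃ star : HeckeAlgebra k μ →ₐ[ℚ] (HeckeAlgebra k μ)ᵐᵒᵖ,
    ∀ (τ : Below μ) (s t : PermOrbit k τ.1 μ),
      star (cellElt μ τ s t) = MulOpposite.op (cellElt μ τ t s) := by
  choose T hT using fun a : HeckeAlgebra k μ =>
    exists_kernel_eq (transpose_mem_invKer (kernel_mem_invKer a))
  have hmul : ∀ a b : HeckeAlgebra k μ, kernel (a * b) = kernel a * kernel b := kernel_comp
  -- The kernel `E` of `1` is a right unit and `Eᵀ` is the kernel of `T 1`. Transposing `Eᵀ E = Eᵀ`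
  -- gives `Eᵀ E = E`, hence `Eᵀ = E`.
  have h1 : T 1 = 1 := by
    have hr : ∀ a : HeckeAlgebra k μ, kernel a * kernel (1 : HeckeAlgebra k μ) = kernel a :=
      fun a => by rw [← hmul, mul_one]
    apply kernel_injective
    have h := congrArg Matrix.transpose (hr (T 1))
    rw [Matrix.transpose_mul, hT, Matrix.transpose_transpose, ← hT 1, hr] at h
    exact h
  let f : HeckeAlgebra k μ →ₗ[ℚ] (HeckeAlgebra k μ)ᵐᵒᵖ :=
    { toFun := fun a => MulOpposite.op (T a)
      map_add' := fun a b => by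
        rw [← MulOpposite.op_add]
        congr 1
        apply kernel_injective
        rw [map_add, hT, hT, hT, map_add, Matrix.transpose_add]
      map_smul' := fun c a => by
        rw [RingHom.id_apply, ← MulOpposite.op_smul]
        congr 1
        apply kernel_injective
        rw [map_smul, hT, hT, map_smul, Matrix.transpose_smul] }
  refine ⟨AlgHom.ofLinearMap f ?_ ?_, fun τ s t => ?_⟩
  · change MulOpposite.op (T 1) = 1
    rw [h1, MulOpposite.op_one]
  · intro a b
    change MulOpposite.op (T (a * b)) = MulOpposite.op (T a) * MulOpposite.op (T b)
    rw [← MulOpposite.op_mul]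
    congr 1
    apply kernel_injective
    rw [hmul, hT, hT, hT, hmul, Matrix.transpose_mul]
  · change MulOpposite.op (T (cellElt μ τ s t)) = _
    congr 1
    apply kernel_injective
    rw [hT, kernel_cellElt, kernel_cellElt, Matrix.transpose_mul, Matrix.transpose_transpose]

/-- Straightening the transpose of the kernel of `a ∘ g_{sᵒᵖ}` yields the coefficients `α` before
`t` enters. The remainder factors through raised types, so after multiplication by `g_t` it lies in
the span of strictly more dominant cells. -/
lemma mul_cellElt_mod (τ : Below μ) (s : PermOrbit k τ.1 μ) (a : HeckeAlgebra k μ) :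
    ∃ α : PermOrbit k τ.1 μ → ℚ, ∀ t : PermOrbit k τ.1 μ,
      a * cellElt μ τ s t - ∑ v, α v • (cellElt μ τ v t : HeckeAlgebra k μ) ∈
        Submodule.span ℚ {x : HeckeAlgebra k μ |
          ∃ ω, τ < ω ∧ ∃ u v : PermOrbit k ω.1 μ, x = cellElt μ ω u v} := by
  have hC := invKer_le_span (transpose_mem_invKer
    (mul_mem_invKer (kernel_mem_invKer a) (kernel_mem_invKer (geom s.1.op))))
  rw [Submodule.span_union] at hC
  obtain ⟨S, hS, R, hR, hSR⟩ := Submodule.mem_sup.mp hC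
  have hS' : S ∈ Submodule.span ℚ (Set.range fun v : PermOrbit k τ.1 μ => kernel (geom v.1)) := by
    refine Submodule.span_mono ?_ hS
    rintro _ ⟨z, x, h, rfl⟩
    exact h.exists_permOrbit
  obtain ⟨α, rfl⟩ := (Submodule.mem_span_range_iff_exists_fun ℚ).mp hS'
  refine ⟨α, fun t => ?_⟩
  have hR' : R.transpose * kernel (geom t.1) ∈ (Submodule.span ℚ {x : HeckeAlgebra k μ |
      ∃ ω, τ < ω ∧ ∃ u v : PermOrbit k ω.1 μ, x = cellElt μ ω u v}).map kernel := by
    clear hSR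
    induction hR using Submodule.span_induction with
    | mem C hC =>
      obtain ⟨i, hi, I, hI, G, hG, rfl⟩ := hC
      rw [Matrix.transpose_mul, Matrix.mul_assoc]
      have h1 := mul_mem_cellSpan (transpose_mem_invKer hG)
        (mul_mem_invKer (transpose_mem_invKer hI) (kernel_mem_invKer (geom t.1)))
      have h2 := cellSpan_le_map_kernel ((dominatesFn_raiseRow hi).trans τ.2) h1
      refine Submodule.map_mono (Submodule.span_mono ?_) h2
      rintro _ ⟨ω, hω, u, v, rfl⟩
      exact ⟨ω, lt_of_dominatesFn_raiseRow hi hω, u, v, rfl⟩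
    | zero => rw [Matrix.transpose_zero, Matrix.zero_mul]; exact zero_mem _
    | add C D _ _ h1 h2 => rw [Matrix.transpose_add, Matrix.add_mul]; exact add_mem h1 h2
    | smul c C _ h =>
      rw [Matrix.transpose_smul, Matrix.smul_mul]; exact Submodule.smul_mem _ _ h
  obtain ⟨b, hb, hbR⟩ := hR'
  have e : a * cellElt μ τ s t - ∑ v, α v • (cellElt μ τ v t : HeckeAlgebra k μ) = b := by
    apply kernel_injective
    have h1 : kernel (a * cellElt μ τ s t) = kernel a * kernel (cellElt μ τ s t) := kernel_comp _ _
    have h2 : kernel a * (kernel (geom s.1)).transpose =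
        (∑ v, α v • (kernel (geom v.1)).transpose) + R.transpose := by
      have := congrArg Matrix.transpose hSR
      rw [Matrix.transpose_transpose, Matrix.transpose_add, Matrix.transpose_sum,
        kernel_geom_op] at this
      simpa only [Matrix.transpose_smul] using this.symm
    rw [hbR, map_sub, map_sum, h1, kernel_cellElt, ← Matrix.mul_assoc, h2, Matrix.add_mul,
      Matrix.sum_mul]
    simp only [map_smul, kernel_cellElt, Matrix.smul_mul]
    rw [add_sub_cancel_left]
  rw [e]
  exact hb

theorem isCellularBasis_cellElt : IsCellularBasis ℚ (cellElt (k := k) μ) where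
  linearIndependent := linearIndependent_cellElt μ
  span_eq_top := span_cellElt μ
  exists_star := exists_star_cellElt μ
  mul_mod := mul_cellElt_mod μ

end Main
end FlagHecke

theorem theorem3p5 {k : Type*} [Field k] [Finite k] {n : ℕ} (hn : 0 < n) (μ : n.Partition) :
    IsCellularBasis ℚ (FlagHecke.cellElt (k := k) μ) ∧
      IsCellularAlgebra ℚ (FlagHecke.HeckeAlgebra k μ) :=
  ⟨FlagHecke.isCellularBasis_cellElt μ, FlagHecke.Below μ, inferInstance, inferInstance,
    fun ν => FlagHecke.PermOrbit k ν.1 μ, inferInstance, _, FlagHecke.isCellularBasis_cellElt μ⟩
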